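/- Let $(\Omega,\mathcal F,\mu)$ be a probability space which is either non-atomic (it has no atoms, an atom being a measurable set $A$ with $\mu(A)>0$ such that every measurable $B\subseteq A$ satisfies $\mu(B)=0$ or $\mu(A\setminus B)=0$) or completely atomic (every measurable set of positive measure contains an atom) with all atoms having equal measure. Let $\mathcal L_0$ be the space of measurable real-valued functions on $\Omega$, functions that agree almost everywhere being identified. Let $X\subseteq\mathcal L_0$ be a rearrangement invariant Banach function space with the Fatou property; that is, $X$ is a linear subspace of $\mathcal L_0$ with a norm $\|\cdot\|_X$ such that 1. (ideal property) if $f\in\mathcal L_0$, $g\in X$ and $|f|\le|g|$ a.e., then $f\in X$ and $\|f\|_X\le\|g\|_X$; 2. (Fatou property) if $f_n\in X$, $f\in\mathcal L_0$, $0\le f_n\uparrow f$ a.e. and $\sup_n\|f_n\|_X<\infty$, then $f\in X$ and $\|f_n\|_X\to\|f\|_X$; 3. (rearrangement invariance) if $f\in X$, $g\in\mathcal L_0$ and $\mu(\{|f|>t\})=\mu(\{|g|>t\})$ for all $t$, then $g\in X$ and $\|f\|_X=\|g\|_X$. The associate space $X'$ consists of all $f\in\mathcal L_0$ such that $fh$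 is integrable for every $h\in X$ with $\|h\|_X\le1$ and $$\|f\|_{X'}:=\sup\Big\{\int_\Omega fh\,d\mu : h\in X,\ \|h\|_X\le 1\Big\}<\infty .$$ Write $f_\Omega:=\int_\Omega f\,d\mu$ for integrable $f$ (and $f_\Omega:=0$ if $f$ is not integrable; by the claims below this convention is used at most for $g$ in part (b) when $X=\{0\}$, where both sides of the inequality vanish). (a) If $f,g\in X$ are essentially bounded, then $fg-(fg)_\Omega$, $f-f_\Omega$ and $g-g_\Omega$ belong to $X$, and $$\|fg-(fg)_\Omega\|_X\le\|f\|_\infty\,\|g-g_\Omega\|_X+\|g\|_\infty\,\|f-f_\Omega\|_X .$$ (b) If $f\in X$ and $g\in X'$, then $f$ and $fg$ are integrable, $g$ is integrable if $X\ne\{0\}$, $f-f_\Omega\in X$, $g-g_\Omega\in X'$, and $$\|fg-(fg)_\Omega\|_1\le\|f\|_X\,\|g-g_\Omega\|_{X'}+\|g\|_{X'}\,\|f-f_\Omega\|_X .$$ -/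

import Mathlib

open MeasureTheory Filter Topology
open scoped ENNReal

/-- A (measure-theoretic) atom: a measurable set of positive measure, each measurable subset of
which has measure zero or full measure in it. -/
def IsMeasureAtom {Ω : Type*} [MeasurableSpace Ω] (μ : Measure Ω) (A : Set Ω) : Prop :=
  MeasurableSet A ∧ μ A ≠ 0 ∧ ∀ B ⊆ A, MeasurableSet B → μ B = 0 ∨ μ (A \ B) = 0

/-- A measure without atoms. (Mathlib's `NoAtoms` only says that points are null sets.) -/
def IsNonatomicMeasure {Ω : Type*} [MeasurableSpace Ω] (μ : Measure Ω) : Prop :=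
  ∀ A : Set Ω, ¬ IsMeasureAtom μ A

/-- Completely atomic (each measurable set of positive measure contains an atom), with all atoms
having equal measure. -/
def IsEquiAtomicMeasure {Ω : Type*} [MeasurableSpace Ω] (μ : Measure Ω) : Prop :=
  (∀ E : Set Ω, MeasurableSet E → μ E ≠ 0 → ∃ A ⊆ E, IsMeasureAtom μ A) ∧
    ∀ A B : Set Ω, IsMeasureAtom μ A → IsMeasureAtom μ B → μ A = μ B

/-- Two functions are equimeasurable if `|f|` and `|g|` have the same distribution function. -/
def Equimeasurable {Ω : Type*} [MeasurableSpace Ω] {μ : Measure Ω} (f g : Ω →ₘ[μ] ℝ) : Prop :=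
  ∀ t : ℝ, μ {x | t < |f x|} = μ {x | t < |g x|}

/-- A Banach function space with the Fatou property: a linear space of (a.e. classes of) measurable
real functions with a norm that satisfies the ideal property and the Fatou property.
Only the values of `norm` on `carrier` are meaningful. -/
structure BanachFunctionSpace {Ω : Type*} [MeasurableSpace Ω] (μ : Measure Ω) where
  /-- the functions that belong to the space -/
  carrier : Submodule ℝ (Ω →ₘ[μ] ℝ)
  /-- the norm -/
  norm : (Ω →ₘ[μ] ℝ) → ℝ
  eq_zero_of_norm_eq_zero : ∀ f ∈ carrier, norm f = 0 → f = 0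
  norm_smul : ∀ (c : ℝ), ∀ f ∈ carrier, norm (c • f) = |c| * norm f
  norm_add_le : ∀ f ∈ carrier, ∀ g ∈ carrier, norm (f + g) ≤ norm f + norm g
  ideal : ∀ f : Ω →ₘ[μ] ℝ, ∀ g ∈ carrier, (∀ᵐ x ∂μ, |f x| ≤ |g x|) →
    f ∈ carrier ∧ norm f ≤ norm g
  fatou : ∀ (u : ℕ → (Ω →ₘ[μ] ℝ)) (f : Ω →ₘ[μ] ℝ),
    (∀ n, u n ∈ carrier) → (∃ C : ℝ, ∀ n, norm (u n) ≤ C) →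
    (∀ᵐ x ∂μ, (∀ n, 0 ≤ u n x) ∧ Monotone (fun n => u n x) ∧
      Tendsto (fun n => u n x) atTop (𝓝 (f x))) →
    f ∈ carrier ∧ Tendsto (fun n => norm (u n)) atTop (𝓝 (norm f))

namespace BanachFunctionSpace

/-- Rearrangement invariance. -/
def RearrangementInvariant {Ω : Type*} [MeasurableSpace Ω] {μ : Measure Ω}
    (X : BanachFunctionSpace μ) : Prop :=
  ∀ f ∈ X.carrier, ∀ g : Ω →ₘ[μ] ℝ, Equimeasurable f g → g ∈ X.carrier ∧ X.norm f = X.norm g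

/-- The numbers `∫ f h` with `h` in the closed unit ball of `X`. -/
def assocPairings {Ω : Type*} [MeasurableSpace Ω] {μ : Measure Ω}
    (X : BanachFunctionSpace μ) (f : Ω →ₘ[μ] ℝ) : Set ℝ :=
  {r | ∃ h ∈ X.carrier, X.norm h ≤ 1 ∧ r = ∫ x, f x * h x ∂μ}

/-- The associate space `X'`: the measurable functions `f` for which all integrals `∫ f h`,
`h` in the unit ball of `X`, exist and have a finite supremum. -/
def assoc {Ω : Type*} [MeasurableSpace Ω] {μ : Measure Ω}
    (X : BanachFunctionSpace μ) : Set (Ω →ₘ[μ] ℝ) :=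
  {f | (∀ h ∈ X.carrier, X.norm h ≤ 1 → Integrable (fun x => f x * h x) μ) ∧
    BddAbove (X.assocPairings f)}

/-- The norm of the associate space `X'`: the supremum of `∫ f h` over the unit ball of `X`. -/
noncomputable def assocNorm {Ω : Type*} [MeasurableSpace Ω] {μ : Measure Ω}
    (X : BanachFunctionSpace μ) (f : Ω →ₘ[μ] ℝ) : ℝ :=
  sSup (X.assocPairings f)

end BanachFunctionSpace

/-- The mean oscillation `f - f_Ω` (for integrable `f`), where `f_Ω = ∫ f dμ`. -/
noncomputable def centered {Ω : Type*} [MeasurableSpace Ω] {μ : Measure Ω}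
    (f : Ω →ₘ[μ] ℝ) : Ω →ₘ[μ] ℝ :=
  f - AEEqFun.const Ω (∫ x, f x ∂μ)

/-!
The inequalities come from averaging, over `y`, the symmetric Leibniz rule
`(f g)(x) - (f g)(y) = (g(x) + g(y)) / 2 * (f(x) - f(y)) + (f(x) + f(y)) / 2 * (g(x) - g(y))`.
As `f` and `f - f_Ω` have the same differences, this writes `f g - (f g)_Ω` as `T_g (f - f_Ω) +
T_f (g - g_Ω)` (`coeFn_centered_mul`). Since `φ = f - f_Ω` has mean zero, one may add a multiple
of `∫ φ` and put
`T_g φ (x) = ∫ ((g(x) + g(y)) / 2 * φ(x) + (g(x) - g(y)) / 2 * φ(y)) dy`.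
The operator `leibnizOp μ ε h` is of this form, with `ε = 1` for `T_h` and `ε = -1` for the
operator `S_h` in which the two weights are interchanged.

The weights satisfy `|g(x) + g(y)| / 2 + |g(x) - g(y)| / 2 = max |g(x)| |g(y)|` and are symmetric up
to sign, so that for `|g| ≤ 1` both operators are dominated by a doubly stochastic kernel. For step
functions over a partition into pieces of equal measure the kernel is a doubly stochastic matrix,
hence by Birkhoff's theorem an average of permutations, which preserve a rearrangement invariant
norm (`IsEquipartition.mem_and_norm_leibnizOp_le`). On an equi-atomic space all functions are such
step functions; on a nonatomic space each pair of functions is an almost everywhere limit of such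
step functions (`IsNonatomicMeasure.hasStepApproximations`, by Sierpiński's theorem), and the Fatou
property carries the bound to the limit. So `T_g` and `S_g` are contractions of `X`
(`BanachFunctionSpace.mem_and_norm_leibnizOp_le`). As `S_1` is the averaging operator `f ↦ f_Ω`,
this also shows that `X`, unless trivial, contains the constants and embeds into `L¹`.

The first inequality follows at once. For the second one, test `f g - (f g)_Ω` against its sign `h`
and use the duality `∫ h * T_g φ = ∫ g * S_h φ` (`integral_mul_leibnizOp`) together with the
contractivity of `S_h` on `X`.
-/

/-! ### Elementary properties of Banach function spaces -/

namespace BanachFunctionSpace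

variable {Ω : Type*} [MeasurableSpace Ω] {μ : Measure Ω}

lemma norm_zero (X : BanachFunctionSpace μ) : X.norm 0 = 0 := by
  simpa using X.norm_smul 0 0 X.carrier.zero_mem

lemma norm_neg (X : BanachFunctionSpace μ) {f : Ω →ₘ[μ] ℝ} (hf : f ∈ X.carrier) :
    X.norm (-f) = X.norm f := by
  simpa using X.norm_smul (-1) f hf

lemma norm_nonneg (X : BanachFunctionSpace μ) {f : Ω →ₘ[μ] ℝ} (hf : f ∈ X.carrier) :
    0 ≤ X.norm f := by
  have h := X.norm_add_le f hf (-f) (X.carrier.neg_mem hf)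
  rw [add_neg_cancel, X.norm_zero, X.norm_neg hf] at h
  linarith

lemma norm_sum_le (X : BanachFunctionSpace μ) {ι : Type*} (s : Finset ι)
    (u : ι → (Ω →ₘ[μ] ℝ)) (hu : ∀ i, u i ∈ X.carrier) :
    X.norm (∑ i ∈ s, u i) ≤ ∑ i ∈ s, X.norm (u i) := by
  classical
  induction s using Finset.induction_on with
  | empty => simp [X.norm_zero]
  | insert i s hi ih =>
    rw [Finset.sum_insert hi, Finset.sum_insert hi]
    exact (X.norm_add_le _ (hu i) _ (X.carrier.sum_mem fun j _ => hu j)).trans (by linarith)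

/-- The norm is lower semicontinuous along almost everywhere convergence: the Fatou property
applied to the increasing sequence `n ↦ ⨅ k, |u (n + k)|`. -/
lemma mem_and_norm_le_of_tendsto (X : BanachFunctionSpace μ) {u : ℕ → (Ω →ₘ[μ] ℝ)}
    {f : Ω →ₘ[μ] ℝ} {C : ℝ} (hu : ∀ n, u n ∈ X.carrier) (hC : ∀ n, X.norm (u n) ≤ C)
    (h : ∀ᵐ x ∂μ, Tendsto (fun n => u n x) atTop (𝓝 (f x))) :
    f ∈ X.carrier ∧ X.norm f ≤ C := by
  have hm : ∀ n, Measurable fun x => ⨅ k, |u (n + k) x| := fun n =>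
    Measurable.iInf fun k => (u (n + k)).measurable.abs
  have hbdd : ∀ n x, BddBelow (Set.range fun k => |u (n + k) x|) := fun n x =>
    ⟨0, by rintro _ ⟨k, rfl⟩; exact abs_nonneg _⟩
  let v : ℕ → (Ω →ₘ[μ] ℝ) := fun n => AEEqFun.mk _ (hm n).aestronglyMeasurable
  have hv : ∀ n, ∀ᵐ x ∂μ, v n x = ⨅ k, |u (n + k) x| := fun n => AEEqFun.coeFn_mk _ _
  have hv' : ∀ n, v n ∈ X.carrier ∧ X.norm (v n) ≤ X.norm (u n) := by
    intro n
    refine X.ideal _ _ (hu n) ?_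
    filter_upwards [hv n] with x hx
    rw [hx, abs_of_nonneg (Real.iInf_nonneg fun k => abs_nonneg _)]
    exact ciInf_le (hbdd n x) 0
  have key := X.fatou v (|f|) (fun n => (hv' n).1) ⟨C, fun n => (hv' n).2.trans (hC n)⟩ ?_
  · have hf := X.ideal f (|f|) key.1 (by
      filter_upwards [AEEqFun.coeFn_abs f] with x hx
      rw [hx, abs_abs])
    exact ⟨hf.1, hf.2.trans (le_of_tendsto' key.2 fun n => (hv' n).2.trans (hC n))⟩
  · filter_upwards [ae_all_iff.2 hv, h, AEEqFun.coeFn_abs f] with x hx hlim habs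
    simp only [hx, habs]
    refine ⟨fun n => Real.iInf_nonneg fun k => abs_nonneg _, ?_, ?_⟩
    · refine monotone_nat_of_le_succ fun n => le_ciInf fun k => ?_
      have := ciInf_le (hbdd n x) (k + 1)
      simpa only [show n + (k + 1) = n + 1 + k by ring] using this
    · rw [Metric.tendsto_atTop]
      intro ε hε
      obtain ⟨N, hN⟩ := Metric.tendsto_atTop.1 hlim.abs (ε / 2) (half_pos hε)
      refine ⟨N, fun n hn => ?_⟩
      have h1 : ⨅ k, |u (n + k) x| ≤ |u n x| := ciInf_le (hbdd n x) 0
      have h2 : |f x| - ε / 2 ≤ ⨅ k, |u (n + k) x| := le_ciInf fun k => by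
        have := hN (n + k) (by omega)
        rw [Real.dist_eq, abs_lt] at this
        linarith
      have h3 := hN n hn
      rw [Real.dist_eq, abs_lt] at h3 ⊢
      constructor <;> linarith

end BanachFunctionSpace

/-! ### Step functions over equipartitions -/

section Equipartition

variable {Ω : Type*} [MeasurableSpace Ω]

/-- An equipartition of `Ω` into `n` measurable sets of measure `1 / n`, encoded by the map that
sends a point to the index of its piece. Step functions over the partition are the functions
`b ∘ π` with `b : Fin n → ℝ`. -/
structure IsEquipartition (μ : Measure Ω) {n : ℕ} (π : Ω → Fin n) : Prop where
  measurable : Measurable π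
  measure_fiber : ∀ i, μ (π ⁻¹' {i}) = (n : ℝ≥0∞)⁻¹

variable {μ : Measure Ω} {n : ℕ} {π : Ω → Fin n}

/-- The averaging operator `f ↦ ∫ ((h + ε h(y)) / 2 * f + (h - ε h(y)) / 2 * f(y)) dy` on a
probability space, with the integral over `y` carried out. It is used for `ε = 1` and `ε = -1`. -/
noncomputable def leibnizOp (μ : Measure Ω) (ε : ℝ) (h f : Ω → ℝ) (x : Ω) : ℝ :=
  ((h x + ε * ∫ y, h y ∂μ) * f x + h x * ∫ y, f y ∂μ - ε * ∫ y, h y * f y ∂μ) / 2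

namespace IsEquipartition

lemma measurable_comp (hπ : IsEquipartition μ π) (b : Fin n → ℝ) :
    Measurable fun x => b (π x) :=
  (measurable_of_finite b).comp hπ.measurable

lemma integral_comp [IsFiniteMeasure μ] (hπ : IsEquipartition μ π) (b : Fin n → ℝ) :
    ∫ x, b (π x) ∂μ = (n : ℝ)⁻¹ * ∑ i, b i := by
  rw [← integral_map (f := b) hπ.measurable.aemeasurable
    (measurable_of_finite b).aestronglyMeasurable,
    integral_fintype (.of_finite), Finset.mul_sum]
  refine Finset.sum_congr rfl fun i _ => ?_
  rw [map_measureReal_apply hπ.measurable (measurableSet_singleton i), measureReal_def,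
    hπ.measure_fiber]
  simp

/-- A property of the index of the piece which holds almost everywhere holds for each index,
because no piece is a null set. -/
lemma forall_of_ae (hπ : IsEquipartition μ π) {p : Fin n → Prop} (h : ∀ᵐ x ∂μ, p (π x))
    (i : Fin n) : p i := by
  by_contra hi
  have h0 : μ (π ⁻¹' {i}) = 0 := measure_mono_null (fun x hx => by
    simp only [Set.mem_preimage, Set.mem_singleton_iff] at hx
    simpa [hx] using hi) (ae_iff.1 h)
  rw [hπ.measure_fiber] at h0
  simp at h0

/-- Permuting the pieces does not change distributions. -/
lemma equimeasurable_comp_perm (hπ : IsEquipartition μ π) (b : Fin n → ℝ)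
    (σ : Equiv.Perm (Fin n)) {u v : Ω →ₘ[μ] ℝ} (hu : u =ᵐ[μ] fun x => b (π x))
    (hv : v =ᵐ[μ] fun x => |b (σ (π x))|) : Equimeasurable u v := by
  have hmap : μ.map (σ ∘ π) = μ.map π := by
    refine Measure.ext_of_singleton fun i => ?_
    rw [Measure.map_apply ((measurable_of_finite σ).comp hπ.measurable)
      (measurableSet_singleton i), Measure.map_apply hπ.measurable (measurableSet_singleton i),
      hπ.measure_fiber, ← hπ.measure_fiber (σ.symm i)]
    congr 1
    ext x
    simp [Equiv.eq_symm_apply]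
  intro t
  have h1 : μ {x | t < |u x|} = μ {x | t < |b (π x)|} := measure_congr (eventuallyEq_set.2 (by
    filter_upwards [hu] with x hx
    simp [hx]))
  have h2 : μ {x | t < |v x|} = μ {x | t < |b (σ (π x))|} := measure_congr (eventuallyEq_set.2 (by
    filter_upwards [hv] with x hx
    simp [hx]))
  have hS : MeasurableSet {i | t < |b i|} := Set.Finite.measurableSet (Set.toFinite _)
  have h3 := Measure.map_apply (μ := μ) hπ.measurable hS
  have h4 := Measure.map_apply (μ := μ) ((measurable_of_finite σ).comp hπ.measurable) hS
  rw [h1, h2]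
  exact h3.symm.trans ((congrArg (fun ν => ν {i | t < |b i|}) hmap.symm).trans h4)

/-- A step function which is dominated by the image of another one under a doubly stochastic matrix
has the smaller norm. By Birkhoff's theorem the matrix is an average of permutations, and these
act isometrically on step functions. -/
lemma mem_and_norm_le_of_doublyStochastic (hπ : IsEquipartition μ π)
    {X : BanachFunctionSpace μ} (hX : X.RearrangementInvariant)
    {M : Matrix (Fin n) (Fin n) ℝ} (hM : M ∈ doublyStochastic ℝ (Fin n))
    {b d : Fin n → ℝ} (hd : ∀ i, |d i| ≤ ∑ j, M i j * |b j|) {u v : Ω →ₘ[μ] ℝ}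
    (hu : u =ᵐ[μ] fun x => b (π x)) (hv : v =ᵐ[μ] fun x => d (π x)) (huX : u ∈ X.carrier) :
    v ∈ X.carrier ∧ X.norm v ≤ X.norm u := by
  obtain ⟨w, hw0, hw1, hwM⟩ := exists_eq_sum_perm_of_mem_doublyStochastic hM
  have hsum : ∀ i, ∑ j, M i j * |b j| = ∑ σ, w σ * |b (σ i)| := by
    intro i
    rw [← hwM]
    simp only [Matrix.sum_apply, Matrix.smul_apply, smul_eq_mul, Finset.sum_mul]
    rw [Finset.sum_comm]
    refine Finset.sum_congr rfl fun σ _ => ?_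
    simp [Equiv.Perm.permMatrix, Equiv.toPEquiv_apply, PEquiv.toMatrix_apply, eq_comm]
  let U : Equiv.Perm (Fin n) → (Ω →ₘ[μ] ℝ) := fun σ =>
    AEEqFun.mk (fun x => |b (σ (π x))|)
      (hπ.measurable_comp fun i => |b (σ i)|).aestronglyMeasurable
  have hU : ∀ σ, U σ =ᵐ[μ] fun x => |b (σ (π x))| := fun σ => AEEqFun.coeFn_mk _ _
  have hUX : ∀ σ, U σ ∈ X.carrier ∧ X.norm u = X.norm (U σ) := fun σ =>
    hX u huX _ (hπ.equimeasurable_comp_perm b σ hu (hU σ))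
  have hwU : ∀ σ, w σ • U σ ∈ X.carrier := fun σ => X.carrier.smul_mem _ (hUX σ).1
  have key := X.ideal v (∑ σ, w σ • U σ) (X.carrier.sum_mem fun σ _ => hwU σ) (by
    have h1 := AEEqFun.coeFn_finsetSum (μ := μ) Finset.univ fun σ => w σ • U σ
    have h2 : ∀ᵐ x ∂μ, ∀ σ, (w σ • U σ) x = w σ * |b (σ (π x))| := by
      refine ae_all_iff.2 fun σ => ?_
      filter_upwards [AEEqFun.coeFn_smul (w σ) (U σ), hU σ] with x hx hx'
      simp [hx, hx']
    filter_upwards [hv, h1, h2] with x hx h1 h2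
    rw [hx, h1]
    simp only [Finset.sum_apply, h2]
    exact (hd _).trans ((hsum _).le.trans (le_abs_self _)))
  refine ⟨key.1, key.2.trans ((X.norm_sum_le _ _ hwU).trans (le_of_eq ?_))⟩
  calc ∑ σ, X.norm (w σ • U σ) = ∑ σ, w σ * X.norm u := by
        refine Finset.sum_congr rfl fun σ _ => ?_
        rw [X.norm_smul _ _ (hUX σ).1, abs_of_nonneg (hw0 σ), (hUX σ).2]
    _ = X.norm u := by rw [← Finset.sum_mul, hw1, one_mul]

/-- For `|h| ≤ 1` the two weights in `leibnizOp` satisfy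
`|h x + ε h y| / 2 + |h x - ε h y| / 2 ≤ 1` and are symmetric in `x` and `y` up to sign. So on step
functions the operator is dominated by a doubly stochastic matrix. -/
lemma mem_and_norm_leibnizOp_le [IsProbabilityMeasure μ] (hπ : IsEquipartition μ π)
    {X : BanachFunctionSpace μ} (hX : X.RearrangementInvariant) {ε : ℝ} (hε : ε = 1 ∨ ε = -1)
    {a b : Fin n → ℝ} (ha : ∀ i, |a i| ≤ 1) {u v : Ω →ₘ[μ] ℝ}
    (hu : u =ᵐ[μ] fun x => b (π x))
    (hv : v =ᵐ[μ] leibnizOp μ ε (fun x => a (π x)) (fun x => b (π x))) (huX : u ∈ X.carrier) :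
    v ∈ X.carrier ∧ X.norm v ≤ X.norm u := by
  have hn : (n : ℝ) ≠ 0 := by
    obtain ⟨x⟩ := nonempty_of_isProbabilityMeasure μ
    exact_mod_cast (Fin.pos (π x)).ne'
  have hn0 : (0 : ℝ) ≤ (n : ℝ)⁻¹ := by positivity
  have hw : ∀ i j, |a i + ε * a j| / 2 + |a i - ε * a j| / 2 ≤ 1 := by
    intro i j
    have h1 := abs_le.1 (ha i)
    have h2 := abs_le.1 (ha j)
    rcases hε with rfl | rfl <;>
    · rcases abs_cases (a i + _ * a j) with ⟨h3, _⟩ | ⟨h3, _⟩ <;>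
      rcases abs_cases (a i - _ * a j) with ⟨h4, _⟩ | ⟨h4, _⟩ <;>
      rw [h3, h4] <;> linarith
  have hsymm : ∀ i j, |a i - ε * a j| = |a j - ε * a i| := by
    intro i j
    rcases hε with rfl | rfl
    · simpa using abs_sub_comm (a i) (a j)
    · congr 1; ring
  let M : Matrix (Fin n) (Fin n) ℝ := Matrix.of fun i j =>
    (n : ℝ)⁻¹ * (|a i - ε * a j| / 2) +
      if i = j then (n : ℝ)⁻¹ * ∑ k, (1 - |a i - ε * a k| / 2) else 0
  have hdiag : ∀ i, 0 ≤ (n : ℝ)⁻¹ * ∑ k, (1 - |a i - ε * a k| / 2) := fun i =>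
    mul_nonneg hn0 (Finset.sum_nonneg fun k _ => by
      have := hw i k
      have := abs_nonneg (a i + ε * a k)
      linarith)
  have hone : ∀ i, (n : ℝ)⁻¹ * ∑ k, (|a i - ε * a k| / 2) +
      (n : ℝ)⁻¹ * ∑ k, (1 - |a i - ε * a k| / 2) = 1 := by
    intro i
    rw [← mul_add, ← Finset.sum_add_distrib]
    simp [hn]
  have hM : M ∈ doublyStochastic ℝ (Fin n) := by
    rw [mem_doublyStochastic_iff_sum]
    refine ⟨fun i j => ?_, fun i => ?_, fun j => ?_⟩
    · have h1 : 0 ≤ (n : ℝ)⁻¹ * (|a i - ε * a j| / 2) := by positivity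
      have h2 := hdiag i
      simp only [M, Matrix.of_apply]
      split_ifs <;> linarith
    · simp only [M, Matrix.of_apply, Finset.sum_add_distrib, Finset.sum_ite_eq, Finset.mem_univ,
        if_true, ← Finset.mul_sum]
      exact hone i
    · simp only [M, Matrix.of_apply, Finset.sum_add_distrib, Finset.sum_ite_eq', Finset.mem_univ,
        if_true, ← Finset.mul_sum, hsymm _ j]
      exact hone j
  let d : Fin n → ℝ := fun i =>
    (n : ℝ)⁻¹ * ∑ j, ((a i + ε * a j) / 2 * b i + (a i - ε * a j) / 2 * b j)
  refine hπ.mem_and_norm_le_of_doublyStochastic hX hM (d := d) (fun i => ?_) hu (hv.trans ?_) huX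
  · calc |d i| ≤ (n : ℝ)⁻¹ * ∑ j, ((1 - |a i - ε * a j| / 2) * |b i|
          + |a i - ε * a j| / 2 * |b j|) := by
          simp only [d]
          rw [abs_mul, abs_of_nonneg hn0]
          refine mul_le_mul_of_nonneg_left ((Finset.abs_sum_le_sum_abs _ _).trans
            (Finset.sum_le_sum fun j _ => ?_)) hn0
          refine (abs_add_le _ _).trans ?_
          simp only [abs_mul, abs_div, abs_two]
          gcongr
          linarith [hw i j]
      _ = ∑ j, M i j * |b j| := by
          simp only [M, Matrix.of_apply, add_mul, ite_mul, zero_mul, Finset.sum_add_distrib,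
            Finset.sum_ite_eq, Finset.mem_univ, if_true]
          rw [mul_add, add_comm, Finset.mul_sum, ← Finset.sum_mul]
          simp only [mul_assoc]
  · refine .of_forall fun x => ?_
    have h1 := hπ.integral_comp a
    have h2 := hπ.integral_comp b
    have h3 := hπ.integral_comp fun i => a i * b i
    simp only [leibnizOp, d, h1, h2, h3]
    have h4 : ∀ j, (a (π x) + ε * a j) / 2 * b (π x) + (a (π x) - ε * a j) / 2 * b j =
        a (π x) * b (π x) / 2 + ε * b (π x) / 2 * a j + a (π x) / 2 * b j
          - ε / 2 * (a j * b j) := fun j => by ring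
    simp only [h4, Finset.sum_add_distrib, Finset.sum_sub_distrib, ← Finset.mul_sum,
      Finset.sum_const, Finset.card_univ, Fintype.card_fin, nsmul_eq_mul]
    field_simp

end IsEquipartition

end Equipartition

/-! ### Approximation by step functions over equipartitions -/

section Approximation

variable {Ω : Type*} [MeasurableSpace Ω] {μ : Measure Ω}

lemma IsNonatomicMeasure.exists_subset_measure_le_half (hμ : IsNonatomicMeasure μ)
    [IsFiniteMeasure μ] {E : Set Ω} (hE : MeasurableSet E) (hE0 : μ E ≠ 0) :
    ∃ B ⊆ E, MeasurableSet B ∧ μ B ≠ 0 ∧ μ B ≤ μ E / 2 := by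
  have h := hμ E
  simp only [IsMeasureAtom, not_and, not_forall, not_or] at h
  obtain ⟨B, hBE, hB, hB0, hB1⟩ := h hE hE0
  rcases le_or_gt (μ B) (μ E / 2) with h1 | h1
  · exact ⟨B, hBE, hB, hB0, h1⟩
  · refine ⟨E \ B, Set.sdiff_subset, hE.diff hB, hB1, ?_⟩
    rw [measure_sdiff hBE hB.nullMeasurableSet (measure_ne_top _ _)]
    refine tsub_le_iff_left.2 ?_
    calc μ E = μ E / 2 + μ E / 2 := (ENNReal.add_halves _).symm
      _ ≤ μ B + μ E / 2 := by gcongr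

lemma IsNonatomicMeasure.exists_subset_measure_le (hμ : IsNonatomicMeasure μ)
    [IsFiniteMeasure μ] {E : Set Ω} (hE : MeasurableSet E) (hE0 : μ E ≠ 0) {δ : ℝ≥0∞}
    (hδ : δ ≠ 0) : ∃ B ⊆ E, MeasurableSet B ∧ μ B ≠ 0 ∧ μ B ≤ δ := by
  have key : ∀ n : ℕ, ∃ B ⊆ E, MeasurableSet B ∧ μ B ≠ 0 ∧ μ B ≤ μ E * 2⁻¹ ^ n := by
    intro n
    induction n with
    | zero => exact ⟨E, subset_rfl, hE, hE0, by simp⟩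
    | succ n ih =>
      obtain ⟨B, hBE, hB, hB0, hBn⟩ := ih
      obtain ⟨C, hCB, hC, hC0, hCn⟩ := hμ.exists_subset_measure_le_half hB hB0
      refine ⟨C, hCB.trans hBE, hC, hC0, hCn.trans ?_⟩
      rw [pow_succ, ← mul_assoc, ENNReal.div_eq_inv_mul, mul_comm]
      gcongr
  have hlim : Tendsto (fun n : ℕ => μ E * (2⁻¹ : ℝ≥0∞) ^ n) atTop (𝓝 (μ E * 0)) :=
    ENNReal.Tendsto.const_mul
      (ENNReal.tendsto_pow_atTop_nhds_zero_of_lt_one (by simp)) (.inr (measure_ne_top _ _))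
  rw [mul_zero] at hlim
  obtain ⟨n, hn⟩ := (hlim.eventually (gt_mem_nhds (pos_iff_ne_zero.2 hδ))).exists
  obtain ⟨B, h1, h2, h3, h4⟩ := key n
  exact ⟨B, h1, h2, h3, h4.trans hn.le⟩

/-- Sierpiński's theorem: a nonatomic finite measure takes all values between `0` and `μ E` on the
measurable subsets of `E`. The set is built by adding, again and again, a subset that is at least
half as large as any other admissible one. -/
lemma IsNonatomicMeasure.exists_subset_measure_eq (hμ : IsNonatomicMeasure μ)
    [IsFiniteMeasure μ] {E : Set Ω} (hE : MeasurableSet E) {c : ℝ≥0∞} (hc : c ≤ μ E) :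
    ∃ B ⊆ E, MeasurableSet B ∧ μ B = c := by
  have hctop : c ≠ ∞ := (hc.trans_lt (measure_lt_top _ _)).ne
  let T := {B : Set Ω // B ⊆ E ∧ MeasurableSet B ∧ μ B ≤ c}
  have step : ∀ B : T, ∃ B' : T, B.1 ⊆ B'.1 ∧ ∀ D ⊆ E \ B.1, MeasurableSet D →
      μ B.1 + μ D ≤ c → μ D ≤ 2 * μ (B'.1 \ B.1) := by
    rintro ⟨B, hBE, hB, hBc⟩
    let s : ℝ≥0∞ := ⨆ (D : Set Ω) (_ : D ⊆ E \ B ∧ MeasurableSet D ∧ μ B + μ D ≤ c), μ D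
    have hs : ∀ D ⊆ E \ B, MeasurableSet D → μ B + μ D ≤ c → μ D ≤ s := fun D h1 h2 h3 =>
      le_iSup₂_of_le D ⟨h1, h2, h3⟩ le_rfl
    have hs_fin : s ≠ ∞ := by
      refine ((iSup₂_le fun D _ => measure_mono (Set.subset_univ D)).trans_lt
        (measure_lt_top μ Set.univ)).ne
    rcases eq_or_ne s 0 with h0 | h0
    · refine ⟨⟨B, hBE, hB, hBc⟩, subset_rfl, fun D h1 h2 h3 => ?_⟩
      have := hs D h1 h2 h3
      rw [h0] at this
      exact this.trans (zero_le)
    · obtain ⟨D, hD⟩ := lt_iSup_iff.1 (ENNReal.half_lt_self h0 hs_fin)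
      obtain ⟨⟨hDE, hDm, hDc⟩, hDs⟩ := lt_iSup_iff.1 hD
      have hdisj : Disjoint B D := Set.disjoint_left.2 fun x hx hx' => (hDE hx').2 hx
      refine ⟨⟨B ∪ D, Set.union_subset hBE (hDE.trans Set.sdiff_subset), hB.union hDm, ?_⟩,
        Set.subset_union_left, fun D' h1 h2 h3 => (hs D' h1 h2 h3).trans ?_⟩
      · rwa [measure_union hdisj hDm]
      · rw [Set.union_sdiff_left, hdisj.symm.sdiff_eq_left]
        calc s = s / 2 + s / 2 := (ENNReal.add_halves s).symm
          _ ≤ μ D + μ D := by gcongr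
          _ = 2 * μ D := (two_mul _).symm
  choose next hnext hlarge using step
  let B : ℕ → T := fun n => next^[n] ⟨∅, Set.empty_subset _, .empty, by simp⟩
  have hB : ∀ n, B (n + 1) = next (B n) := fun n => Function.iterate_succ_apply' _ _ _
  have hmono : Monotone fun n => (B n).1 := monotone_nat_of_le_succ fun n => by
    rw [hB]; exact hnext _
  have hle : μ (⋃ n, (B n).1) ≤ c := by
    rw [hmono.measure_iUnion]
    exact iSup_le fun n => (B n).2.2.2
  refine ⟨⋃ n, (B n).1, Set.iUnion_subset fun n => (B n).2.1,
    .iUnion fun n => (B n).2.2.1, hle.antisymm (not_lt.1 fun hlt => ?_)⟩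
  -- Otherwise a fixed set `D` of positive measure stays admissible for ever.
  have hdiff : μ (E \ ⋃ n, (B n).1) ≠ 0 := fun h0 => by
    have h2 : μ E ≤ μ (⋃ n, (B n).1) := by
      calc μ E ≤ μ ((E \ ⋃ n, (B n).1) ∪ ⋃ n, (B n).1) := measure_mono (by simp)
        _ ≤ μ (E \ ⋃ n, (B n).1) + μ (⋃ n, (B n).1) := measure_union_le _ _
        _ = μ (⋃ n, (B n).1) := by rw [h0, zero_add]
    exact absurd (hc.trans h2) (not_le.2 hlt)
  obtain ⟨D, hDE, hD, hD0, hDc⟩ := hμ.exists_subset_measure_le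
    (hE.diff (.iUnion fun n => (B n).2.2.1)) hdiff (tsub_pos_of_lt hlt).ne'
  have hD2 : ∀ n, μ D ≤ 2 * μ ((B (n + 1)).1 \ (B n).1) := fun n => by
    rw [hB]
    refine hlarge _ D (hDE.trans (Set.sdiff_subset_sdiff_right (Set.subset_iUnion_of_subset n
      subset_rfl))) hD ?_
    calc μ (B n).1 + μ D ≤ μ (⋃ n, (B n).1) + (c - μ (⋃ n, (B n).1)) := by
          gcongr
          exact Set.subset_iUnion_of_subset n subset_rfl
      _ = c := add_tsub_cancel_of_le hle
  have hgrow : ∀ n : ℕ, n * μ D ≤ 2 * μ (B n).1 := by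
    intro n
    induction n with
    | zero => simp
    | succ n ih =>
      have h1 : μ (B (n + 1)).1 = μ (B n).1 + μ ((B (n + 1)).1 \ (B n).1) := by
        rw [← measure_union Set.disjoint_sdiff_right
          ((B (n + 1)).2.2.1.diff (B n).2.2.1), Set.union_sdiff_cancel (hmono n.le_succ)]
      rw [h1, mul_add]
      push_cast
      rw [add_mul, one_mul]
      exact add_le_add ih (hD2 n)
  obtain ⟨n, hn⟩ := ENNReal.exists_nat_mul_gt hD0 (ENNReal.mul_ne_top ENNReal.ofNat_ne_top hctop :
    2 * c ≠ ∞)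
  exact absurd ((hgrow n).trans (by gcongr; exact (B n).2.2.2)) (not_le.2 hn)

/-- A label function with values in `ℕ` and fibres of equal measure gives an equipartition. -/
lemma exists_isEquipartition_of_nat [IsProbabilityMeasure μ] {p : Ω → ℕ} (hp : Measurable p)
    {k : ℕ} (hk : ∀ᵐ x ∂μ, p x < k) {c : ℝ≥0∞} (hc : ∀ i < k, μ (p ⁻¹' {i}) = c) :
    ∃ π : Ω → Fin k, IsEquipartition μ π ∧ ∀ᵐ x ∂μ, (π x : ℕ) = p x := by
  have hk0 : 0 < k := by
    obtain ⟨x, hx⟩ := hk.exists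
    omega
  let π : Ω → Fin k := fun x => if h : p x < k then ⟨p x, h⟩ else ⟨0, hk0⟩
  have hπ : Measurable π :=
    (measurable_from_nat (f := fun i => if h : i < k then (⟨i, h⟩ : Fin k) else ⟨0, hk0⟩)).comp hp
  have hπp : ∀ᵐ x ∂μ, (π x : ℕ) = p x := by
    filter_upwards [hk] with x hx
    simp [π, hx]
  have hfib : ∀ i, μ (π ⁻¹' {i}) = c := fun i => by
    rw [← hc i i.2]
    refine measure_congr (eventuallyEq_set.2 ?_)
    filter_upwards [hπp] with x hx
    simp [← hx, Fin.ext_iff]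
  refine ⟨π, ⟨hπ, fun i => ?_⟩, hπp⟩
  rw [hfib]
  have h1 : ∑ i : Fin k, μ (π ⁻¹' {i}) = μ (π ⁻¹' (Finset.univ : Finset (Fin k))) :=
    sum_measure_preimage_singleton _ fun i _ => hπ (measurableSet_singleton i)
  simp only [hfib, Finset.coe_univ, Set.preimage_univ, measure_univ, Finset.sum_const,
    Finset.card_univ, Fintype.card_fin, nsmul_eq_mul] at h1
  rw [mul_comm] at h1
  exact ENNReal.eq_inv_of_mul_eq_one_left h1

/-- Greedy subdivision of a set `R` of measure `k / N` into `k` pieces of measure `1 / N` on which a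
simple function `F` is constant, for as long as some level set of `F` has room for a piece. The
remaining pieces lie in a set `D` whose measure is at most `1 / N` times the number of values. -/
lemma IsNonatomicMeasure.exists_subdivision (hμ : IsNonatomicMeasure μ) [IsFiniteMeasure μ]
    {β : Type*} (F : SimpleFunc Ω β) (N : ℕ) (k : ℕ) :
    ∀ R : Set Ω, MeasurableSet R → μ R = k * (N : ℝ≥0∞)⁻¹ →
      ∃ (p : Ω → ℕ) (D : Set Ω), Measurable p ∧ (∀ᵐ x ∂μ, x ∈ R → p x < k) ∧
        (∀ i < k, μ (R ∩ p ⁻¹' {i}) = (N : ℝ≥0∞)⁻¹) ∧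
        μ D ≤ F.range.card * (N : ℝ≥0∞)⁻¹ ∧
        ∀ i < k, (∃ y, ∀ᵐ x ∂μ, x ∈ R → p x = i → F x = y) ∨
          ∀ᵐ x ∂μ, x ∈ R → p x = i → x ∈ D := by
  classical
  induction k with
  | zero =>
    intro R hR hR0
    have hR0 : μ R = 0 := by simpa using hR0
    refine ⟨fun _ => 0, ∅, measurable_const, ?_, by simp, by simp, by simp⟩
    filter_upwards [measure_eq_zero_iff_ae_notMem.1 hR0] with x hx hx'
    exact absurd hx' hx
  | succ k ih =>
    intro R hR hRk
    obtain ⟨A, hAR, hA, hAN, hAF⟩ : ∃ A ⊆ R, MeasurableSet A ∧ μ A = (N : ℝ≥0∞)⁻¹ ∧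
        ((∃ y, ∀ x ∈ A, F x = y) ∨ μ R ≤ F.range.card * (N : ℝ≥0∞)⁻¹) := by
      by_cases h : ∃ y, (N : ℝ≥0∞)⁻¹ ≤ μ (R ∩ F ⁻¹' {y})
      · obtain ⟨y, hy⟩ := h
        obtain ⟨A, hAR, hA, hAN⟩ := hμ.exists_subset_measure_eq
          (hR.inter (F.measurableSet_fiber y)) hy
        exact ⟨A, hAR.trans Set.inter_subset_left, hA, hAN,
          .inl ⟨y, fun x hx => (hAR hx).2⟩⟩
      · push Not at h
        obtain ⟨A, hAR, hA, hAN⟩ := hμ.exists_subset_measure_eq hR (c := (N : ℝ≥0∞)⁻¹) (by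
          rw [hRk]
          push_cast
          rw [add_mul, one_mul]
          exact le_add_self)
        refine ⟨A, hAR, hA, hAN, .inr ?_⟩
        calc μ R ≤ μ (⋃ y ∈ F.range, R ∩ F ⁻¹' {y}) := measure_mono fun x hx => by
              simp only [Set.mem_iUnion]
              exact ⟨F x, F.mem_range_self x, hx, rfl⟩
          _ ≤ ∑ y ∈ F.range, μ (R ∩ F ⁻¹' {y}) := measure_biUnion_finset_le _ _
          _ ≤ ∑ _y ∈ F.range, (N : ℝ≥0∞)⁻¹ := Finset.sum_le_sum fun y _ => (h y).le
          _ = F.range.card * (N : ℝ≥0∞)⁻¹ := by simp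
    obtain ⟨p, D, hp, hpk, hpN, hD, hpD⟩ := ih (R \ A) (hR.diff hA) (by
      have h1 : μ R = μ A + μ (R \ A) := by
        rw [← measure_union Set.disjoint_sdiff_right (hR.diff hA), Set.union_sdiff_cancel hAR]
      have hAtop : (N : ℝ≥0∞)⁻¹ ≠ ∞ := hAN ▸ measure_ne_top _ _
      rw [hRk, hAN] at h1
      push_cast at h1
      rw [add_mul, one_mul, add_comm] at h1
      exact ((ENNReal.add_right_inj hAtop).1 h1).symm)
    have hq : ∀ i < k, ∀ x ∈ R, (if x ∈ A then k else p x) = i → x ∈ R \ A ∧ p x = i := by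
      intro i hi x hx hxi
      split_ifs at hxi with hxA
      · omega
      · exact ⟨⟨hx, hxA⟩, hxi⟩
    have hqk : ∀ᵐ x ∂μ, x ∈ R → (if x ∈ A then k else p x) = k → x ∈ A := by
      filter_upwards [hpk] with x hx hxR hxk
      by_contra hxA
      have := hx ⟨hxR, hxA⟩
      simp only [hxA, if_false] at hxk
      omega
    have hmeas : Measurable fun x => if x ∈ A then k else p x :=
      Measurable.ite hA measurable_const hp
    have hlt : ∀ᵐ x ∂μ, x ∈ R → (if x ∈ A then k else p x) < k + 1 := by
      filter_upwards [hpk] with x hx hxR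
      split_ifs with hxA
      · omega
      · have := hx ⟨hxR, hxA⟩
        omega
    have hfib : ∀ i < k + 1,
        μ (R ∩ (fun x => if x ∈ A then k else p x) ⁻¹' {i}) = (N : ℝ≥0∞)⁻¹ := by
      intro i hi
      rcases Nat.lt_succ_iff_lt_or_eq.1 hi with hi | rfl
      · rw [← hpN i hi]
        congr 1
        ext x
        simp only [Set.mem_inter_iff, Set.mem_preimage, Set.mem_singleton_iff]
        refine ⟨fun h => hq i hi x h.1 h.2, fun h => ⟨h.1.1, ?_⟩⟩
        rw [if_neg h.1.2, h.2]
      · rw [← hAN]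
        refine measure_congr (eventuallyEq_set.2 ?_)
        filter_upwards [hqk] with x hx
        exact ⟨fun h => hx h.1 h.2, fun h => ⟨hAR h, by simp [h]⟩⟩
    have hgood : ∀ i < k, ∀ Q : Ω → Prop, (∀ᵐ x ∂μ, x ∈ R \ A → p x = i → Q x) →
        ∀ᵐ x ∂μ, x ∈ R → (if x ∈ A then k else p x) = i → Q x := by
      intro i hi Q hQ
      filter_upwards [hQ] with x hx hxR hxi
      have := hq i hi x hxR hxi
      exact hx this.1 this.2
    rcases hAF with ⟨y, hy⟩ | hRF
    · refine ⟨_, D, hmeas, hlt, hfib, hD, fun i hi => ?_⟩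
      rcases Nat.lt_succ_iff_lt_or_eq.1 hi with hi | rfl
      · exact (hpD i hi).imp (fun ⟨y, hy⟩ => ⟨y, hgood i hi _ hy⟩) (hgood i hi _)
      · refine .inl ⟨y, ?_⟩
        filter_upwards [hqk] with x hx hxR hxi
        exact hy x (hx hxR hxi)
    · exact ⟨_, R, hmeas, hlt, hfib, hRF, fun i _ => .inr (.of_forall fun x hx _ => hx)⟩

/-- On a nonatomic probability space a simple function agrees, off a set of small measure, with a
step function over an equipartition, which may be taken to vanish elsewhere. -/
lemma IsNonatomicMeasure.exists_step_eq_off_small (hμ : IsNonatomicMeasure μ)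
    [IsProbabilityMeasure μ] {β : Type*} [Zero β] (F : SimpleFunc Ω β) {δ : ℝ≥0∞} (hδ : δ ≠ 0) :
    ∃ (n : ℕ) (π : Ω → Fin n) (v : Fin n → β) (D : Set Ω), IsEquipartition μ π ∧ μ D ≤ δ ∧
      (∀ᵐ x ∂μ, x ∉ D → v (π x) = F x) ∧ ∀ᵐ x ∂μ, v (π x) = F x ∨ v (π x) = 0 := by
  classical
  have hlim : Tendsto (fun N : ℕ => (F.range.card : ℝ≥0∞) * (N : ℝ≥0∞)⁻¹) atTop
      (𝓝 (F.range.card * 0)) :=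
    ENNReal.Tendsto.const_mul ENNReal.tendsto_inv_nat_nhds_zero (.inr (by simp))
  rw [mul_zero] at hlim
  obtain ⟨N, hN, hN0⟩ := ((hlim.eventually (gt_mem_nhds (pos_iff_ne_zero.2 hδ))).and
    (eventually_ge_atTop 1)).exists
  obtain ⟨p, D, hp, hpN, hfib, hD, hpD⟩ := hμ.exists_subdivision F N N Set.univ .univ (by
    rw [measure_univ, ENNReal.mul_inv_cancel (by simp; omega) (by simp)])
  simp only [Set.mem_univ, true_imp_iff, Set.univ_inter] at hpN hfib hpD
  obtain ⟨π, hπ, hπp⟩ := exists_isEquipartition_of_nat hp hpN hfib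
  let v : Fin N → β := fun i =>
    if h : ∃ y, ∀ᵐ x ∂μ, p x = i → F x = y then h.choose else 0
  have hv : ∀ᵐ x ∂μ, ∀ i : Fin N, p x = i →
      v i = F x ∨ (v i = 0 ∧ x ∈ D) := by
    refine ae_all_iff.2 fun i => ?_
    by_cases h : ∃ y, ∀ᵐ x ∂μ, p x = i → F x = y
    · filter_upwards [h.choose_spec] with x hx hxi
      left
      simp only [v, dif_pos h]
      exact (hx hxi).symm
    · filter_upwards [(hpD i i.2).resolve_left h] with x hx hxi
      exact .inr ⟨by simp only [v, dif_neg h], hx hxi⟩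
  refine ⟨N, π, v, D, hπ, hD.trans hN.le, ?_, ?_⟩
  · filter_upwards [hv, hπp] with x hx hxp hxD
    exact (hx (π x) hxp.symm).resolve_right fun h => hxD h.2
  · filter_upwards [hv, hπp] with x hx hxp
    exact (hx (π x) hxp.symm).imp_right And.left

lemma exists_simpleFunc_tendsto_abs_le {f : Ω → ℝ} (hf : Measurable f) :
    ∃ s : ℕ → SimpleFunc Ω ℝ, (∀ k x, |s k x| ≤ |f x|) ∧
      ∀ x, Tendsto (fun k => s k x) atTop (𝓝 (f x)) := by
  have hle : ∀ {g : Ω → ℝ}, Measurable g → ∀ k x,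
      (SimpleFunc.eapprox (fun x => ENNReal.ofReal (g x)) k x).toReal ≤ max (g x) 0 := by
    intro g hg k x
    refine ENNReal.toReal_le_of_le_ofReal (le_max_right _ _) ?_
    refine (le_iSup (fun k => SimpleFunc.eapprox (fun x => ENNReal.ofReal (g x)) k x) k).trans ?_
    rw [SimpleFunc.iSup_eapprox_apply hg.ennreal_ofReal]
    exact ENNReal.ofReal_le_ofReal (le_max_left _ _)
  have hlim : ∀ {g : Ω → ℝ}, Measurable g → ∀ x, Tendsto
      (fun k => (SimpleFunc.eapprox (fun x => ENNReal.ofReal (g x)) k x).toReal) atTop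
      (𝓝 (max (g x) 0)) := by
    intro g hg x
    have h1 := SimpleFunc.tendsto_eapprox hg.ennreal_ofReal x
    have h2 := (ENNReal.tendsto_toReal ENNReal.ofReal_ne_top).comp h1
    simpa [ENNReal.toReal_ofReal'] using! h2
  refine ⟨fun k => (SimpleFunc.eapprox (fun x => ENNReal.ofReal (f x)) k).map ENNReal.toReal -
    (SimpleFunc.eapprox (fun x => ENNReal.ofReal (-f x)) k).map ENNReal.toReal, ?_, ?_⟩
  · intro k x
    have h1 := hle hf k x
    have h2 := hle hf.neg k x
    simp only [Pi.neg_apply] at h2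
    simp only [SimpleFunc.coe_sub, Pi.sub_apply, SimpleFunc.map_apply]
    have h3 := ENNReal.toReal_nonneg
      (a := SimpleFunc.eapprox (fun x => ENNReal.ofReal (f x)) k x)
    have h4 := ENNReal.toReal_nonneg
      (a := SimpleFunc.eapprox (fun x => ENNReal.ofReal (-f x)) k x)
    rw [abs_le]
    rcases le_total 0 (f x) with h | h
    · rw [max_eq_left h] at h1
      rw [max_eq_right (by linarith)] at h2
      rw [abs_of_nonneg h]
      constructor <;> linarith
    · rw [max_eq_right h] at h1
      rw [max_eq_left (by linarith)] at h2
      rw [abs_of_nonpos h]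
      constructor <;> linarith
  · intro x
    have h := (hlim hf x).sub (hlim hf.neg x)
    simp only [Pi.neg_apply, max_zero_sub_max_neg_zero_eq_self] at h
    exact h

/-- Each pair of measurable functions is the almost everywhere limit of pairs of step functions,
the two functions of a pair being steps over the same equipartition, that are dominated by the
given functions. -/
def HasStepApproximations (μ : Measure Ω) : Prop :=
  ∀ h f : Ω → ℝ, Measurable h → Measurable f →
    ∃ (n : ℕ → ℕ) (π : ∀ k, Ω → Fin (n k)) (a b : ∀ k, Fin (n k) → ℝ),
      (∀ k, IsEquipartition μ (π k)) ∧
      (∀ k, ∀ᵐ x ∂μ, |a k (π k x)| ≤ |h x| ∧ |b k (π k x)| ≤ |f x|) ∧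
      ∀ᵐ x ∂μ, Tendsto (fun k => a k (π k x)) atTop (𝓝 (h x)) ∧
        Tendsto (fun k => b k (π k x)) atTop (𝓝 (f x))

lemma IsNonatomicMeasure.hasStepApproximations [IsProbabilityMeasure μ]
    (hμ : IsNonatomicMeasure μ) : HasStepApproximations μ := by
  intro h f hh hf
  obtain ⟨s, hs, hs'⟩ := exists_simpleFunc_tendsto_abs_le hh
  obtain ⟨t, ht, ht'⟩ := exists_simpleFunc_tendsto_abs_le hf
  have hpos : ∀ k : ℕ, (2⁻¹ : ℝ≥0∞) ^ k ≠ 0 := fun k => pow_ne_zero _ (by simp)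
  choose n π v D hπ hD hv hv0 using fun k =>
    hμ.exists_step_eq_off_small ((s k).pair (t k)) (hpos k)
  refine ⟨n, π, fun k i => (v k i).1, fun k i => (v k i).2, hπ, fun k => ?_, ?_⟩
  · filter_upwards [hv0 k] with x hx
    rcases hx with hx | hx
    · rw [hx]
      exact ⟨hs k x, ht k x⟩
    · simp [hx]
  · -- By Borel–Cantelli almost every point lies in only finitely many exceptional sets.
    have hBC : ∀ᵐ x ∂μ, ∀ᶠ k in atTop, x ∉ D k := by
      refine ae_eventually_notMem (ne_top_of_le_ne_top ?_ (ENNReal.tsum_le_tsum hD))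
      rw [ENNReal.tsum_geometric]
      simp
    filter_upwards [hBC, ae_all_iff.2 hv] with x hx hvx
    have hev : ∀ᶠ k in atTop, v k (π k x) = (s k x, t k x) := by
      filter_upwards [hx] with k hk
      exact hvx k hk
    exact ⟨(hs' x).congr' (hev.mono fun k hk => (congrArg Prod.fst hk).symm),
      (ht' x).congr' (hev.mono fun k hk => (congrArg Prod.snd hk).symm)⟩

lemma IsMeasureAtom.exists_ae_eq_const {A : Set Ω} (hA : IsMeasureAtom μ A) {f : Ω → ℝ}
    (hf : Measurable f) : ∃ c, ∀ᵐ x ∂μ, x ∈ A → f x = c := by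
  obtain ⟨c, hc⟩ := exists_eventuallyEq_const_of_forall_separating
    (l := ae (μ.restrict A)) (f := f) MeasurableSet (fun U hU => by
      rw [ae_restrict_iff' hA.1, ae_restrict_iff' hA.1]
      rcases hA.2.2 (A ∩ f ⁻¹' U) Set.inter_subset_left (hA.1.inter (hf hU)) with h | h
      · right
        filter_upwards [measure_eq_zero_iff_ae_notMem.1 h] with x hx hxA hxU
        exact hx ⟨hxA, hxU⟩
      · left
        filter_upwards [measure_eq_zero_iff_ae_notMem.1 h] with x hx hxA
        by_contra hxU
        exact hx ⟨hxA, fun h => hxU h.2⟩)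
  exact ⟨c, (ae_restrict_iff' hA.1).1 hc⟩

/-- On an equi-atomic space a set of finite measure is, up to a null set, a finite disjoint union of
atoms. The atoms are the fibres of `p` below `k`. -/
lemma IsEquiAtomicMeasure.exists_atoms (hμ : IsEquiAtomicMeasure μ) [IsFiniteMeasure μ]
    {c : ℝ≥0∞} (hc : ∀ A, IsMeasureAtom μ A → μ A = c) (m : ℕ) :
    ∀ E : Set Ω, MeasurableSet E → μ E ≤ m * c →
      ∃ (k : ℕ) (p : Ω → ℕ), Measurable p ∧ (∀ᵐ x ∂μ, x ∈ E → p x < k) ∧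
        ∀ i < k, ∃ A, IsMeasureAtom μ A ∧ ∀ᵐ x ∂μ, x ∈ E ∧ p x = i ↔ x ∈ A := by
  classical
  induction m with
  | zero =>
    intro E hE hE0
    refine ⟨0, fun _ => 0, measurable_const, ?_, by simp⟩
    filter_upwards [measure_eq_zero_iff_ae_notMem.1 (show μ E = 0 by simpa using hE0)]
      with x hx hx'
    exact absurd hx' hx
  | succ m ih =>
    intro E hE hEm
    rcases eq_or_ne (μ E) 0 with h0 | h0
    · exact ih E hE (by simp [h0])
    obtain ⟨A, hAE, hA⟩ := hμ.1 E hE h0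
    obtain ⟨k, p, hp, hpk, hpA⟩ := ih (E \ A) (hE.diff hA.1) (by
      rw [measure_sdiff hAE hA.1.nullMeasurableSet (measure_ne_top _ _), hc A hA]
      refine tsub_le_iff_right.2 (hEm.trans (le_of_eq ?_))
      push_cast
      ring)
    refine ⟨k + 1, fun x => if x ∈ A then k else p x, Measurable.ite hA.1 measurable_const hp,
      ?_, fun i hi => ?_⟩
    · filter_upwards [hpk] with x hx hxE
      split_ifs with hxA
      · omega
      · have := hx ⟨hxE, hxA⟩
        omega
    · rcases Nat.lt_succ_iff_lt_or_eq.1 hi with hi | rfl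
      · obtain ⟨B, hB, hBp⟩ := hpA i hi
        refine ⟨B, hB, ?_⟩
        filter_upwards [hBp] with x hx
        rw [← hx]
        by_cases hxA : x ∈ A
        · simp only [hxA, if_true, Set.mem_sdiff, not_true_eq_false, and_false, false_and,
            iff_false, not_and]
          omega
        · simp [hxA]
      · refine ⟨A, hA, ?_⟩
        filter_upwards [hpk] with x hx
        by_cases hxA : x ∈ A
        · simp [hxA, hAE hxA]
        · simp only [hxA, if_false, iff_false, not_and]
          intro hxE
          have := hx ⟨hxE, hxA⟩
          omega

lemma IsEquiAtomicMeasure.hasStepApproximations [IsProbabilityMeasure μ]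
    (hμ : IsEquiAtomicMeasure μ) : HasStepApproximations μ := by
  intro h f hh hf
  obtain ⟨A₀, -, hA₀⟩ := hμ.1 Set.univ .univ (by simp)
  have hc : ∀ A, IsMeasureAtom μ A → μ A = μ A₀ := fun A hA => hμ.2 A A₀ hA hA₀
  obtain ⟨m, hm⟩ := ENNReal.exists_nat_mul_gt hA₀.2.1 ENNReal.one_ne_top
  obtain ⟨k, p, hp, hpk, hpA⟩ := hμ.exists_atoms hc m Set.univ .univ (by
    rw [measure_univ]; exact hm.le)
  simp only [Set.mem_univ, true_imp_iff, true_and] at hpk hpA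
  obtain ⟨π, hπ, hπp⟩ := exists_isEquipartition_of_nat hp hpk (c := μ A₀) fun i hi => by
    obtain ⟨A, hA, hAp⟩ := hpA i hi
    rw [← hc A hA]
    exact measure_congr (eventuallyEq_set.2 hAp)
  have hconst : ∀ {g : Ω → ℝ}, Measurable g →
      ∃ a : Fin k → ℝ, ∀ᵐ x ∂μ, a (π x) = g x := by
    intro g hg
    have : ∀ i : Fin k, ∃ c, ∀ᵐ x ∂μ, p x = i → g x = c := fun i => by
      obtain ⟨A, hA, hAp⟩ := hpA i i.2
      obtain ⟨c, hc⟩ := hA.exists_ae_eq_const hg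
      refine ⟨c, ?_⟩
      filter_upwards [hAp, hc] with x hx hxc hxi
      exact hxc (hx.1 hxi)
    choose a ha using this
    refine ⟨a, ?_⟩
    filter_upwards [ae_all_iff.2 ha, hπp] with x hx hxp
    exact (hx (π x) hxp.symm).symm
  obtain ⟨a, ha⟩ := hconst hh
  obtain ⟨b, hb⟩ := hconst hf
  refine ⟨fun _ => k, fun _ => π, fun _ => a, fun _ => b, fun _ => hπ, fun _ => ?_, ?_⟩
  · filter_upwards [ha, hb] with x hx hx'
    simp [hx, hx']
  · filter_upwards [ha, hb] with x hx hx'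
    simp [hx, hx']

end Approximation

/-! ### The averaging operator on a rearrangement invariant space -/

section LeibnizInequalities

variable {Ω : Type*} [MeasurableSpace Ω] {μ : Measure Ω}

lemma leibnizOp_congr {ε : ℝ} {h h' f f' : Ω → ℝ} (hh : h =ᵐ[μ] h') (hf : f =ᵐ[μ] f') :
    leibnizOp μ ε h f =ᵐ[μ] leibnizOp μ ε h' f' := by
  have h1 := integral_congr_ae hh
  have h2 := integral_congr_ae hf
  have h3 : ∫ x, h x * f x ∂μ = ∫ x, h' x * f' x ∂μ := integral_congr_ae (hh.mul hf)
  filter_upwards [hh, hf] with x hx hx'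
  simp only [leibnizOp, h1, h2, h3, hx, hx']

lemma Measurable.leibnizOp {ε : ℝ} {h f : Ω → ℝ} (hh : Measurable h) (hf : Measurable f) :
    Measurable (leibnizOp μ ε h f) := by
  unfold _root_.leibnizOp
  fun_prop

/-- If `|h| ≤ 1`, then `leibnizOp μ ε h` is a contraction on every rearrangement invariant space:
pass to the limit from step functions by dominated convergence and lower semicontinuity. -/
lemma BanachFunctionSpace.mem_and_norm_leibnizOp_le [IsProbabilityMeasure μ]
    (hμ : HasStepApproximations μ) {X : BanachFunctionSpace μ} (hX : X.RearrangementInvariant)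
    {ε : ℝ} (hε : ε = 1 ∨ ε = -1) {h f v : Ω →ₘ[μ] ℝ} (hh : ∀ᵐ x ∂μ, |h x| ≤ 1)
    (hf : f ∈ X.carrier) (hfi : Integrable f μ) (hv : v =ᵐ[μ] leibnizOp μ ε h f) :
    v ∈ X.carrier ∧ X.norm v ≤ X.norm f := by
  obtain ⟨n, π, a, b, hπ, hle, hlim⟩ := hμ h f h.measurable f.measurable
  have ha1 : ∀ k i, |a k i| ≤ 1 := fun k => (hπ k).forall_of_ae (by
    filter_upwards [hle k, hh] with x hx hx'
    exact hx.1.trans hx')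
  have hma := fun k => (hπ k).measurable_comp (a k)
  have hmb := fun k => (hπ k).measurable_comp (b k)
  let u : ℕ → (Ω →ₘ[μ] ℝ) := fun k => AEEqFun.mk _ (hmb k).aestronglyMeasurable
  have hu : ∀ k, u k =ᵐ[μ] fun x => b k (π k x) := fun k => AEEqFun.coeFn_mk _ _
  have huX : ∀ k, u k ∈ X.carrier ∧ X.norm (u k) ≤ X.norm f := fun k =>
    X.ideal _ _ hf (by
      filter_upwards [hu k, hle k] with x hx hx'
      rw [hx]
      exact hx'.2)
  let w : ℕ → (Ω →ₘ[μ] ℝ) := fun k =>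
    AEEqFun.mk _ ((hma k).leibnizOp (μ := μ) (ε := ε) (hmb k)).aestronglyMeasurable
  have hw : ∀ k, w k =ᵐ[μ] leibnizOp μ ε (fun x => a k (π k x)) (fun x => b k (π k x)) :=
    fun k => AEEqFun.coeFn_mk _ _
  have hwX : ∀ k, w k ∈ X.carrier ∧ X.norm (w k) ≤ X.norm (u k) := fun k =>
    (hπ k).mem_and_norm_leibnizOp_le hX hε (ha1 k) (hu k) (hw k) (huX k).1
  refine X.mem_and_norm_le_of_tendsto (fun k => (hwX k).1)
    (fun k => (hwX k).2.trans (huX k).2) ?_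
  have l1 : Tendsto (fun k => ∫ x, a k (π k x) ∂μ) atTop (𝓝 (∫ x, h x ∂μ)) :=
    tendsto_integral_of_dominated_convergence (fun _ => 1)
      (fun k => (hma k).aestronglyMeasurable) (integrable_const 1)
      (fun k => .of_forall fun x => ha1 k _) (hlim.mono fun x hx => hx.1)
  have l2 : Tendsto (fun k => ∫ x, b k (π k x) ∂μ) atTop (𝓝 (∫ x, f x ∂μ)) :=
    tendsto_integral_of_dominated_convergence (fun x => |f x|)
      (fun k => (hmb k).aestronglyMeasurable) hfi.abs
      (fun k => (hle k).mono fun x hx => hx.2) (hlim.mono fun x hx => hx.2)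
  have l3 : Tendsto (fun k => ∫ x, a k (π k x) * b k (π k x) ∂μ) atTop
      (𝓝 (∫ x, h x * f x ∂μ)) :=
    tendsto_integral_of_dominated_convergence (fun x => |f x|)
      (fun k => ((hma k).mul (hmb k)).aestronglyMeasurable) hfi.abs
      (fun k => (hle k).mono fun x hx => by
        rw [Real.norm_eq_abs, abs_mul]
        calc _ ≤ 1 * |f x| := mul_le_mul (ha1 k _) hx.2 (abs_nonneg _) zero_le_one
          _ = |f x| := one_mul _)
      (hlim.mono fun x hx => hx.1.mul hx.2)
  filter_upwards [hlim, hv, ae_all_iff.2 hw] with x hx hvx hwx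
  simp only [hvx, hwx, leibnizOp]
  exact (((((hx.1.add (l1.const_mul ε)).mul hx.2).add (hx.1.mul l2)).sub
    (l3.const_mul ε)).div_const 2)

lemma BanachFunctionSpace.mem_and_norm_leibnizOp_le_mul [IsProbabilityMeasure μ]
    (hμ : HasStepApproximations μ) {X : BanachFunctionSpace μ} (hX : X.RearrangementInvariant)
    {ε : ℝ} (hε : ε = 1 ∨ ε = -1) {h f v : Ω →ₘ[μ] ℝ} {c : ℝ} (hc : 0 ≤ c)
    (hh : ∀ᵐ x ∂μ, |h x| ≤ c)
    (hf : f ∈ X.carrier) (hfi : Integrable f μ) (hv : v =ᵐ[μ] leibnizOp μ ε h f) :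
    v ∈ X.carrier ∧ X.norm v ≤ c * X.norm f := by
  rcases hc.eq_or_lt with rfl | hc
  · have hh0 : h =ᵐ[μ] fun _ => (0 : ℝ) := by
      filter_upwards [hh] with x hx
      exact abs_nonpos_iff.1 hx
    have hv0 : v = 0 := AEEqFun.ext (by
      filter_upwards [hv.trans (leibnizOp_congr hh0 (ae_eq_refl _)),
        AEEqFun.coeFn_zero (α := Ω) (β := ℝ) (μ := μ)] with x hx hx'
      rw [hx, hx']
      simp [leibnizOp])
    rw [hv0, X.norm_zero, zero_mul]
    exact ⟨X.carrier.zero_mem, le_rfl⟩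
  · have hch := AEEqFun.coeFn_smul c⁻¹ h
    have key := X.mem_and_norm_leibnizOp_le hμ hX hε (h := c⁻¹ • h) (v := c⁻¹ • v) (by
        filter_upwards [hch, hh] with x hx hx'
        rw [hx, Pi.smul_apply, smul_eq_mul, abs_mul, abs_of_pos (inv_pos.2 hc)]
        exact (inv_mul_le_one₀ hc).2 hx') hf hfi (by
      refine (AEEqFun.coeFn_smul c⁻¹ v).trans (EventuallyEq.trans ?_
        (leibnizOp_congr hch (ae_eq_refl _)).symm)
      filter_upwards [hv] with x hx
      simp only [Pi.smul_apply, smul_eq_mul, hx, leibnizOp, integral_const_mul, mul_assoc]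
      ring)
    have hvX : v ∈ X.carrier := by
      simpa [smul_smul, hc.ne'] using X.carrier.smul_mem c key.1
    refine ⟨hvX, ?_⟩
    rw [X.norm_smul _ _ hvX, abs_of_pos (inv_pos.2 hc)] at key
    exact (inv_mul_le_iff₀ hc).1 key.2

/-- Averaging over the whole space is the case `h = 1`, `ε = -1`. -/
lemma BanachFunctionSpace.mem_and_norm_const_integral_le [IsProbabilityMeasure μ]
    (hμ : HasStepApproximations μ) {X : BanachFunctionSpace μ} (hX : X.RearrangementInvariant)
    {f : Ω →ₘ[μ] ℝ} (hf : f ∈ X.carrier) (hfi : Integrable f μ) :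
    (AEEqFun.const Ω (∫ x, f x ∂μ) : Ω →ₘ[μ] ℝ) ∈ X.carrier ∧
      X.norm (AEEqFun.const Ω (∫ x, f x ∂μ)) ≤ X.norm f := by
  refine X.mem_and_norm_leibnizOp_le hμ hX (ε := -1) (.inr rfl)
    (h := AEEqFun.const Ω 1) ?_ hf hfi ?_
  · filter_upwards [AEEqFun.coeFn_const (μ := μ) Ω (1 : ℝ)] with x hx
    simp [hx]
  · refine EventuallyEq.trans ?_ (leibnizOp_congr (AEEqFun.coeFn_const Ω (1 : ℝ)).symm
      (ae_eq_refl _))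
    filter_upwards [AEEqFun.coeFn_const (μ := μ) Ω (∫ x, f x ∂μ)] with x hx
    simp [hx, leibnizOp]

/-- The truncation `min |f| c`. -/
noncomputable def truncAbs (f : Ω →ₘ[μ] ℝ) (c : ℝ) : Ω →ₘ[μ] ℝ :=
  AEEqFun.mk (fun x => min |f x| c)
    (f.measurable.abs.min measurable_const).aestronglyMeasurable

lemma coeFn_truncAbs (f : Ω →ₘ[μ] ℝ) (c : ℝ) :
    truncAbs f c =ᵐ[μ] fun x => min |f x| c := AEEqFun.coeFn_mk _ _

lemma integrable_truncAbs [IsFiniteMeasure μ] (f : Ω →ₘ[μ] ℝ) {c : ℝ} (hc : 0 ≤ c) :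
    Integrable (truncAbs f c) μ := by
  refine Integrable.of_bound (truncAbs f c).aestronglyMeasurable c ?_
  filter_upwards [coeFn_truncAbs f c] with x hx
  rw [hx, Real.norm_eq_abs, abs_of_nonneg (le_min (abs_nonneg _) hc)]
  exact min_le_right _ _

lemma BanachFunctionSpace.truncAbs_mem (X : BanachFunctionSpace μ) {f : Ω →ₘ[μ] ℝ}
    (hf : f ∈ X.carrier) {c : ℝ} (hc : 0 ≤ c) :
    truncAbs f c ∈ X.carrier ∧ X.norm (truncAbs f c) ≤ X.norm f := by
  refine X.ideal _ _ hf ?_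
  filter_upwards [coeFn_truncAbs f c] with x hx
  rw [hx, abs_of_nonneg (le_min (abs_nonneg _) hc)]
  exact min_le_left _ _

lemma BanachFunctionSpace.const_mem [IsProbabilityMeasure μ]
    (hμ : HasStepApproximations μ) {X : BanachFunctionSpace μ} (hX : X.RearrangementInvariant)
    (h0 : X.carrier ≠ ⊥) (c : ℝ) : (AEEqFun.const Ω c : Ω →ₘ[μ] ℝ) ∈ X.carrier := by
  obtain ⟨f, hf, hf0⟩ := X.carrier.ne_bot_iff.1 h0
  have hi := integrable_truncAbs f zero_le_one
  have hnn : 0 ≤ᵐ[μ] truncAbs f 1 := by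
    filter_upwards [coeFn_truncAbs f 1] with x hx
    rw [hx]
    exact le_min (abs_nonneg _) zero_le_one
  have hI : ∫ x, truncAbs f 1 x ∂μ ≠ 0 := by
    rw [Ne, integral_eq_zero_iff_of_nonneg_ae hnn hi]
    intro h
    refine hf0 (AEEqFun.ext ?_)
    filter_upwards [h, coeFn_truncAbs f 1, AEEqFun.coeFn_zero (α := Ω) (β := ℝ) (μ := μ)]
      with x h1 h2 h3
    rw [h3]
    rw [h2] at h1
    simp only [Pi.zero_apply] at h1 ⊢
    rcases min_choice |f x| 1 with h4 | h4
    · exact abs_eq_zero.1 (h4.symm.trans h1)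
    · rw [h4] at h1
      exact absurd h1 one_ne_zero
  have h1 := X.mem_and_norm_const_integral_le hμ hX (X.truncAbs_mem hf zero_le_one).1 hi
  have h2 := X.carrier.smul_mem (c / ∫ x, truncAbs f 1 x ∂μ) h1.1
  convert h2 using 1
  refine AEEqFun.ext ?_
  filter_upwards [AEEqFun.coeFn_const (μ := μ) Ω c,
    AEEqFun.coeFn_const (μ := μ) Ω (∫ x, truncAbs f 1 x ∂μ),
    AEEqFun.coeFn_smul (c / ∫ x, truncAbs f 1 x ∂μ)
      (AEEqFun.const Ω (∫ x, truncAbs f 1 x ∂μ) : Ω →ₘ[μ] ℝ)] with x h3 h4 h5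
  rw [h3, h5, Pi.smul_apply, h4]
  simp [hI]

lemma const_one_ne_zero [IsProbabilityMeasure μ] : (AEEqFun.const Ω (1 : ℝ) : Ω →ₘ[μ] ℝ) ≠ 0 := by
  intro h
  have h1 := AEEqFun.coeFn_const (μ := μ) Ω (1 : ℝ)
  rw [h] at h1
  obtain ⟨x, hx, hx'⟩ := (h1.and (AEEqFun.coeFn_zero (α := Ω) (β := ℝ) (μ := μ))).exists
  rw [hx'] at hx
  exact zero_ne_one hx

/-- A rearrangement invariant space embeds into `L¹`: the means of the truncations `min |f| k` are
at most `‖f‖ / ‖1‖`, so `f` is integrable by monotone convergence. -/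
lemma BanachFunctionSpace.exists_integral_abs_le [IsProbabilityMeasure μ]
    (hμ : HasStepApproximations μ) {X : BanachFunctionSpace μ} (hX : X.RearrangementInvariant) :
    ∃ C : ℝ, 0 ≤ C ∧ ∀ f ∈ X.carrier, Integrable f μ ∧ ∫ x, |f x| ∂μ ≤ C * X.norm f := by
  by_cases h0 : X.carrier = ⊥
  · refine ⟨0, le_rfl, fun f hf => ?_⟩
    obtain rfl : f = 0 := by simpa [h0] using hf
    have hz := AEEqFun.coeFn_zero (α := Ω) (β := ℝ) (μ := μ)
    refine ⟨(integrable_congr hz).2 (integrable_zero _ _ _), ?_⟩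
    have : ∫ x, |(0 : Ω →ₘ[μ] ℝ) x| ∂μ = ∫ x, (0 : ℝ) ∂μ := integral_congr_ae (by
      filter_upwards [hz] with x hx
      simp [hx])
    rw [this]
    simp
  have h1 := X.const_mem hμ hX h0 1
  have hκ : 0 < X.norm (AEEqFun.const Ω 1) := (X.norm_nonneg h1).lt_of_ne' fun h =>
    const_one_ne_zero (X.eq_zero_of_norm_eq_zero _ h1 h)
  refine ⟨(X.norm (AEEqFun.const Ω 1))⁻¹, (inv_pos.2 hκ).le, fun f hf => ?_⟩
  rw [inv_mul_eq_div]
  have hmean : ∀ k : ℕ, ∫ x, truncAbs f k x ∂μ ≤ X.norm f / X.norm (AEEqFun.const Ω 1) := by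
    intro k
    have hk := X.truncAbs_mem hf (Nat.cast_nonneg k)
    have h2 := X.mem_and_norm_const_integral_le hμ hX hk.1
      (integrable_truncAbs f (Nat.cast_nonneg k))
    have h3 : (AEEqFun.const Ω (∫ x, truncAbs f k x ∂μ) : Ω →ₘ[μ] ℝ) =
        (∫ x, truncAbs f k x ∂μ) • AEEqFun.const Ω 1 := AEEqFun.ext (by
      filter_upwards [AEEqFun.coeFn_const (μ := μ) Ω (1 : ℝ),
        AEEqFun.coeFn_const (μ := μ) Ω (∫ x, truncAbs f k x ∂μ),
        AEEqFun.coeFn_smul (∫ x, truncAbs f k x ∂μ)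
          (AEEqFun.const Ω (1 : ℝ) : Ω →ₘ[μ] ℝ)] with x h3 h4 h5
      rw [h4, h5, Pi.smul_apply, h3]
      simp)
    rw [h3, X.norm_smul _ _ h1] at h2
    rw [le_div_iff₀ hκ]
    exact (mul_le_mul_of_nonneg_right (le_abs_self _) hκ.le).trans (h2.2.trans hk.2)
  have hC : 0 ≤ X.norm f / X.norm (AEEqFun.const Ω 1) := div_nonneg (X.norm_nonneg hf) hκ.le
  have hlint : ∫⁻ x, ENNReal.ofReal |f x| ∂μ ≤
      ENNReal.ofReal (X.norm f / X.norm (AEEqFun.const Ω 1)) := by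
    have hlim : Tendsto (fun k : ℕ => ∫⁻ x, ENNReal.ofReal (min |f x| k) ∂μ) atTop
        (𝓝 (∫⁻ x, ENNReal.ofReal |f x| ∂μ)) := by
      refine lintegral_tendsto_of_tendsto_of_monotone
        (fun k => (f.measurable.abs.min measurable_const).ennreal_ofReal.aemeasurable)
        (.of_forall fun x => fun k l hkl => ENNReal.ofReal_le_ofReal
          (min_le_min_left _ (Nat.cast_le.2 hkl)))
        (.of_forall fun x => tendsto_const_nhds.congr' ?_)
      filter_upwards [eventually_ge_atTop ⌈|f x|⌉₊] with k hk
      rw [min_eq_left (Nat.ceil_le.1 hk)]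
    refine le_of_tendsto' hlim fun k => ?_
    have h4 : ∫ x, truncAbs f k x ∂μ = ∫ x, min |f x| k ∂μ :=
      integral_congr_ae (coeFn_truncAbs f k)
    rw [← ofReal_integral_eq_lintegral_ofReal
      ((integrable_truncAbs f (Nat.cast_nonneg k)).congr (coeFn_truncAbs f k))
      (.of_forall fun x => le_min (abs_nonneg _) (Nat.cast_nonneg k)), ← h4]
    exact ENNReal.ofReal_le_ofReal (hmean k)
  have hfi : Integrable f μ := by
    refine ⟨f.aestronglyMeasurable, ?_⟩
    rw [hasFiniteIntegral_iff_norm]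
    exact hlint.trans_lt ENNReal.ofReal_lt_top
  refine ⟨hfi, (ENNReal.ofReal_le_ofReal_iff hC).1 ?_⟩
  rwa [ofReal_integral_eq_lintegral_ofReal hfi.abs (.of_forall fun x => abs_nonneg _)]

/-! ### The Leibniz decomposition and its dual form -/

lemma coeFn_centered (f : Ω →ₘ[μ] ℝ) :
    centered f =ᵐ[μ] fun x => f x - ∫ y, f y ∂μ := by
  filter_upwards [AEEqFun.coeFn_sub f (AEEqFun.const Ω (∫ x, f x ∂μ)),
    AEEqFun.coeFn_const (μ := μ) Ω (∫ x, f x ∂μ)] with x h1 h2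
  rw [centered, h1, Pi.sub_apply, h2]
  rfl

lemma leibnizOp_one_comm (h f : Ω → ℝ) : leibnizOp μ 1 h f = leibnizOp μ 1 f h := by
  funext x
  simp only [leibnizOp, mul_comm (h _) (f _)]
  ring

lemma integrable_centered [IsFiniteMeasure μ] {f : Ω →ₘ[μ] ℝ} (hf : Integrable f μ) :
    Integrable (centered f) μ :=
  (hf.sub (integrable_const _)).congr (coeFn_centered f).symm

lemma integral_centered [IsProbabilityMeasure μ] {f : Ω →ₘ[μ] ℝ} (hf : Integrable f μ) :
    ∫ x, centered f x ∂μ = 0 := by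
  rw [integral_congr_ae (coeFn_centered f), integral_sub hf (integrable_const _)]
  simp

lemma integral_mul_centered [IsFiniteMeasure μ] {f g : Ω →ₘ[μ] ℝ} (hg : Integrable g μ)
    (hgf : Integrable (fun x => g x * f x) μ) :
    ∫ x, g x * centered f x ∂μ = ∫ x, g x * f x ∂μ - (∫ x, g x ∂μ) * ∫ x, f x ∂μ := by
  have h1 : ∫ x, g x * centered f x ∂μ = ∫ x, (g x * f x - g x * ∫ y, f y ∂μ) ∂μ :=
    integral_congr_ae (by
      filter_upwards [coeFn_centered f] with x hx
      rw [hx]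
      ring)
  rw [h1, integral_sub hgf (hg.mul_const _), integral_mul_const]

/-- The Leibniz rule: average
`(f g)(x) - (f g)(y) = (g(x) + g(y)) / 2 * (f(x) - f(y)) + (f(x) + f(y)) / 2 * (g(x) - g(y))`
over `y`. -/
lemma coeFn_centered_mul [IsProbabilityMeasure μ] {f g : Ω →ₘ[μ] ℝ} (hf : Integrable f μ)
    (hg : Integrable g μ) (hfg : Integrable (fun x => f x * g x) μ) :
    centered (f * g) =ᵐ[μ] fun x =>
      leibnizOp μ 1 g (centered f) x + leibnizOp μ 1 f (centered g) x := by
  have h1 : ∫ x, (f * g : Ω →ₘ[μ] ℝ) x ∂μ = ∫ x, f x * g x ∂μ :=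
    integral_congr_ae (AEEqFun.coeFn_mul f g)
  have h2 := integral_mul_centered hf hfg
  have h3 := integral_mul_centered hg (hfg.congr (.of_forall fun x => mul_comm _ _))
  filter_upwards [coeFn_centered (f * g), coeFn_centered f, coeFn_centered g,
    AEEqFun.coeFn_mul f g] with x hx hxf hxg hxm
  simp only [leibnizOp, h1, h2, h3, integral_centered hf, integral_centered hg, hx, hxf, hxg, hxm,
    Pi.mul_apply, mul_comm (g _) (f _)]
  ring

/-- For fixed `f` the trilinear form `∫ h * leibnizOp μ 1 g f` is also
`∫ g * leibnizOp μ (-1) h f`. -/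
lemma integral_mul_leibnizOp {h g f : Ω → ℝ} (hh : Integrable h μ) (hg : Integrable g μ)
    (hhg : Integrable (fun x => h x * g x) μ) (hhf : Integrable (fun x => h x * f x) μ)
    (hhgf : Integrable (fun x => h x * (g x * f x)) μ)
    (hgf : Integrable (fun x => g x * f x) μ) :
    ∫ x, h x * leibnizOp μ 1 g f x ∂μ = ∫ x, g x * leibnizOp μ (-1) h f x ∂μ := by
  have key : ∀ {p q r s : Ω → ℝ}, Integrable p μ → Integrable q μ → Integrable r μ →
      Integrable s μ → ∀ b c d : ℝ, ∫ x, (p x / 2 + b * q x + c * r x + d * s x) ∂μ =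
        (∫ x, p x ∂μ) / 2 + b * ∫ x, q x ∂μ + c * ∫ x, r x ∂μ + d * ∫ x, s x ∂μ := by
    intro p q r s hp hq hr hs b c d
    have i1 : Integrable (fun x => p x / 2) μ := hp.div_const 2
    have i2 : Integrable (fun x => p x / 2 + b * q x) μ := i1.add (hq.const_mul b)
    have i3 : Integrable (fun x => p x / 2 + b * q x + c * r x) μ := i2.add (hr.const_mul c)
    rw [integral_add i3 (hs.const_mul d), integral_add i2 (hr.const_mul c),
      integral_add i1 (hq.const_mul b), integral_div, integral_const_mul, integral_const_mul,
      integral_const_mul]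
  have e1 : ∀ x, h x * leibnizOp μ 1 g f x = h x * (g x * f x) / 2 +
      (∫ y, g y ∂μ) / 2 * (h x * f x) + (∫ y, f y ∂μ) / 2 * (h x * g x) +
      -(∫ y, g y * f y ∂μ) / 2 * h x := fun x => by
    simp only [leibnizOp]
    ring
  have e2 : ∀ x, g x * leibnizOp μ (-1) h f x = h x * (g x * f x) / 2 +
      -(∫ y, h y ∂μ) / 2 * (g x * f x) + (∫ y, f y ∂μ) / 2 * (h x * g x) +
      (∫ y, h y * f y ∂μ) / 2 * g x := fun x => by
    simp only [leibnizOp]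
    ring
  simp only [e1, e2]
  rw [key hhgf hhf hhg hh, key hhgf hgf hhg hg]
  ring

/-! ### The associate space -/

namespace BanachFunctionSpace

/-- Hölder's inequality. -/
lemma integrable_mul_and_integral_mul_le {X : BanachFunctionSpace μ} {f k : Ω →ₘ[μ] ℝ}
    (hf : f ∈ X.assoc) (hk : k ∈ X.carrier) :
    Integrable (fun x => f x * k x) μ ∧ ∫ x, f x * k x ∂μ ≤ X.assocNorm f * X.norm k := by
  rcases (X.norm_nonneg hk).eq_or_lt with h0 | h0
  · have hz : (fun x => f x * k x) =ᵐ[μ] fun _ => 0 := by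
      rw [X.eq_zero_of_norm_eq_zero k hk h0.symm]
      filter_upwards [AEEqFun.coeFn_zero (α := Ω) (β := ℝ) (μ := μ)] with x hx
      simp [hx]
    rw [integral_congr_ae hz, ← h0]
    exact ⟨(integrable_congr hz).2 (integrable_zero _ _ _), by simp⟩
  · have hk' : (X.norm k)⁻¹ • k ∈ X.carrier := X.carrier.smul_mem _ hk
    have hk1 : X.norm ((X.norm k)⁻¹ • k) ≤ 1 := by
      rw [X.norm_smul _ _ hk, abs_of_pos (inv_pos.2 h0), inv_mul_cancel₀ h0.ne']
    have he : (fun x => f x * ((X.norm k)⁻¹ • k) x) =ᵐ[μ]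
        fun x => (X.norm k)⁻¹ * (f x * k x) := by
      filter_upwards [AEEqFun.coeFn_smul (X.norm k)⁻¹ k] with x hx
      rw [hx, Pi.smul_apply, smul_eq_mul]
      ring
    have h1 := (hf.1 _ hk' hk1).congr he
    refine ⟨?_, ?_⟩
    · have := h1.const_mul (X.norm k)
      simpa only [mul_inv_cancel_left₀ h0.ne'] using this
    · have h2 : ∫ x, f x * ((X.norm k)⁻¹ • k) x ∂μ ≤ X.assocNorm f :=
        le_csSup hf.2 ⟨_, hk', hk1, rfl⟩
      rw [integral_congr_ae he, integral_const_mul] at h2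
      rwa [inv_mul_le_iff₀ h0, mul_comm] at h2

lemma sub_const_mem_assoc [IsProbabilityMeasure μ] (hμ : HasStepApproximations μ)
    {X : BanachFunctionSpace μ} (hX : X.RearrangementInvariant) {f g : Ω →ₘ[μ] ℝ} {c : ℝ}
    (hf : f ∈ X.assoc) (hg : g =ᵐ[μ] fun x => f x - c) : g ∈ X.assoc := by
  obtain ⟨C, hC, hL1⟩ := X.exists_integral_abs_le hμ hX
  have he : ∀ k : Ω →ₘ[μ] ℝ, (fun x => g x * k x) =ᵐ[μ] fun x => f x * k x - c * k x :=
    fun k => by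
      filter_upwards [hg] with x hx
      rw [hx]
      ring
  have hfk : ∀ k ∈ X.carrier, Integrable (fun x => f x * k x) μ := fun k hk =>
    (X.integrable_mul_and_integral_mul_le hf hk).1
  refine ⟨fun k hk _ => ((hfk k hk).sub ((hL1 k hk).1.const_mul c)).congr (he k).symm,
    X.assocNorm f + |c| * C, ?_⟩
  rintro _ ⟨k, hk, hk1, rfl⟩
  rw [integral_congr_ae (he k), integral_sub (hfk k hk) ((hL1 k hk).1.const_mul c),
    integral_const_mul]
  have h1 : ∫ x, f x * k x ∂μ ≤ X.assocNorm f := le_csSup hf.2 ⟨k, hk, hk1, rfl⟩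
  have h2 : -(c * ∫ x, k x ∂μ) ≤ |c| * C := by
    refine (neg_le_abs _).trans ?_
    rw [abs_mul]
    refine mul_le_mul_of_nonneg_left ?_ (abs_nonneg c)
    refine abs_integral_le_integral_abs.trans ((hL1 k hk).2.trans ?_)
    exact mul_le_of_le_one_right hC hk1
  linarith

lemma integrable_of_mem_assoc [IsProbabilityMeasure μ] (hμ : HasStepApproximations μ)
    {X : BanachFunctionSpace μ} (hX : X.RearrangementInvariant) (h0 : X.carrier ≠ ⊥)
    {g : Ω →ₘ[μ] ℝ} (hg : g ∈ X.assoc) : Integrable g μ := by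
  refine (integrable_mul_and_integral_mul_le hg (X.const_mem hμ hX h0 1)).1.congr ?_
  filter_upwards [AEEqFun.coeFn_const (μ := μ) Ω (1 : ℝ)] with x hx
  simp [hx]

end BanachFunctionSpace

/-! ### The two Leibniz inequalities -/

lemma Integrable.leibnizOp [IsFiniteMeasure μ] {ε : ℝ} {h f : Ω → ℝ} (hh : Integrable h μ)
    (hf : Integrable f μ) (hhf : Integrable (fun x => h x * f x) μ) :
    Integrable (leibnizOp μ ε h f) μ := by
  have h1 := (((hhf.add (hf.const_mul (ε * ∫ y, h y ∂μ))).add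
    (hh.mul_const (∫ y, f y ∂μ))).sub (integrable_const (ε * ∫ y, h y * f y ∂μ))).div_const 2
  refine h1.congr (.of_forall fun x => ?_)
  simp only [_root_.leibnizOp, Pi.add_apply, Pi.sub_apply]
  ring

lemma integrable_mul_centered [IsFiniteMeasure μ] {f g : Ω →ₘ[μ] ℝ} (hg : Integrable g μ)
    (hgf : Integrable (fun x => g x * f x) μ) : Integrable (fun x => g x * centered f x) μ := by
  refine (hgf.sub (hg.mul_const (∫ y, f y ∂μ))).congr ?_
  filter_upwards [coeFn_centered f] with x hx
  rw [hx, Pi.sub_apply]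
  ring

lemma centered_zero : centered (0 : Ω →ₘ[μ] ℝ) = 0 := by
  have hz := AEEqFun.coeFn_zero (α := Ω) (β := ℝ) (μ := μ)
  have h1 : ∫ x, (0 : Ω →ₘ[μ] ℝ) x ∂μ = 0 := by
    rw [integral_congr_ae hz]
    simp
  refine AEEqFun.ext ?_
  filter_upwards [coeFn_centered (0 : Ω →ₘ[μ] ℝ), hz] with x hx hx'
  rw [hx, hx', h1]
  simp

namespace BanachFunctionSpace

lemma centered_mem [IsProbabilityMeasure μ] (hμ : HasStepApproximations μ)
    {X : BanachFunctionSpace μ} (hX : X.RearrangementInvariant) {f : Ω →ₘ[μ] ℝ}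
    (hf : f ∈ X.carrier) : centered f ∈ X.carrier := by
  by_cases h0 : X.carrier = ⊥
  · obtain rfl : f = 0 := by simpa [h0] using hf
    rwa [centered_zero]
  · exact X.carrier.sub_mem hf (X.const_mem hμ hX h0 _)

/-- Both terms of the Leibniz decomposition are values of contractions, up to the factors `‖g‖_∞`
and `‖f‖_∞`. -/
lemma norm_centered_mul_le [IsProbabilityMeasure μ] (hμ : HasStepApproximations μ)
    {X : BanachFunctionSpace μ} (hX : X.RearrangementInvariant) {f g : Ω →ₘ[μ] ℝ}
    (hf : f ∈ X.carrier) (hg : g ∈ X.carrier) (hfb : MemLp f ∞ μ) (hgb : MemLp g ∞ μ) :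
    centered (f * g) ∈ X.carrier ∧ X.norm (centered (f * g)) ≤
      lpNorm f ∞ μ * X.norm (centered g) + lpNorm g ∞ μ * X.norm (centered f) := by
  have hfi : Integrable f μ := hfb.integrable le_top
  have hgi : Integrable g μ := hgb.integrable le_top
  have hfg : Integrable (fun x => f x * g x) μ :=
    hgi.bdd_mul f.aestronglyMeasurable (ae_le_lpNorm_exponent_top hfb)
  let v : Ω →ₘ[μ] ℝ := AEEqFun.mk (leibnizOp μ 1 g (centered f))
    (g.measurable.leibnizOp (centered f).measurable).aestronglyMeasurable
  let w : Ω →ₘ[μ] ℝ := AEEqFun.mk (leibnizOp μ 1 f (centered g))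
    (f.measurable.leibnizOp (centered g).measurable).aestronglyMeasurable
  have hv := X.mem_and_norm_leibnizOp_le_mul hμ hX (.inl rfl) lpNorm_nonneg
    (ae_le_lpNorm_exponent_top hgb) (centered_mem hμ hX hf) (integrable_centered hfi)
    (v := v) (AEEqFun.coeFn_mk _ _)
  have hw := X.mem_and_norm_leibnizOp_le_mul hμ hX (.inl rfl) lpNorm_nonneg
    (ae_le_lpNorm_exponent_top hfb) (centered_mem hμ hX hg) (integrable_centered hgi)
    (v := w) (AEEqFun.coeFn_mk _ _)
  have he : centered (f * g) = v + w := AEEqFun.ext (by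
    filter_upwards [coeFn_centered_mul hfi hgi hfg, AEEqFun.coeFn_add v w,
      AEEqFun.coeFn_mk (leibnizOp μ 1 g (centered f))
        (g.measurable.leibnizOp (μ := μ) (ε := 1) (centered f).measurable).aestronglyMeasurable,
      AEEqFun.coeFn_mk (leibnizOp μ 1 f (centered g))
        (f.measurable.leibnizOp (μ := μ) (ε := 1) (centered g).measurable).aestronglyMeasurable]
      with x h1 h2 h3 h4
    rw [h1, h2, Pi.add_apply, h3, h4])
  rw [he]
  refine ⟨X.carrier.add_mem hv.1 hw.1, (X.norm_add_le _ hv.1 _ hw.1).trans ?_⟩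
  linarith [hv.2, hw.2]

/-- Dualized, the bound for `leibnizOp μ (-1) h` on `X` estimates `∫ h * leibnizOp μ 1 g f`. -/
lemma integral_mul_leibnizOp_le [IsProbabilityMeasure μ] (hμ : HasStepApproximations μ)
    {X : BanachFunctionSpace μ} (hX : X.RearrangementInvariant) {f g h : Ω →ₘ[μ] ℝ}
    (hf : f ∈ X.carrier) (hg : g ∈ X.assoc) (hgi : Integrable g μ)
    (hh : ∀ᵐ x ∂μ, |h x| ≤ 1) :
    ∫ x, h x * leibnizOp μ 1 g f x ∂μ ≤ X.assocNorm g * X.norm f := by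
  obtain ⟨C, -, hL1⟩ := X.exists_integral_abs_le hμ hX
  have hfi := (hL1 f hf).1
  have hgf := (integrable_mul_and_integral_mul_le hg hf).1
  have hbdd : ∀ {k : Ω → ℝ}, Integrable k μ → Integrable (fun x => h x * k x) μ := fun hk =>
    hk.bdd_mul h.aestronglyMeasurable hh
  rw [integral_mul_leibnizOp (Integrable.of_bound h.aestronglyMeasurable 1 hh) hgi
    (hbdd hgi) (hbdd hfi) (hbdd hgf) hgf]
  let v : Ω →ₘ[μ] ℝ := AEEqFun.mk (leibnizOp μ (-1) h f)
    (h.measurable.leibnizOp f.measurable).aestronglyMeasurable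
  have hve : v =ᵐ[μ] leibnizOp μ (-1) h f := AEEqFun.coeFn_mk _ _
  have hv := X.mem_and_norm_leibnizOp_le hμ hX (.inr rfl) hh hf hfi hve
  have he : ∫ x, g x * leibnizOp μ (-1) h f x ∂μ = ∫ x, g x * v x ∂μ := integral_congr_ae (by
    filter_upwards [hve] with x hx
    rw [hx])
  rw [he]
  refine (integrable_mul_and_integral_mul_le hg hv.1).2.trans
    (mul_le_mul_of_nonneg_left hv.2 ?_)
  -- The supremum is nonnegative because the pairing with `h = 0` is among its competitors.
  refine le_csSup hg.2 ⟨0, X.carrier.zero_mem, by simp [X.norm_zero], ?_⟩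
  rw [integral_congr_ae (g := fun _ => (0 : ℝ)) (by
    filter_upwards [AEEqFun.coeFn_zero (α := Ω) (β := ℝ) (μ := μ)] with x hx
    simp [hx])]
  simp

/-- The `L¹` norm is the integral against the sign, to which the Leibniz decomposition and duality
apply. -/
lemma lpNorm_one_centered_mul_le [IsProbabilityMeasure μ] (hμ : HasStepApproximations μ)
    {X : BanachFunctionSpace μ} (hX : X.RearrangementInvariant) {f g : Ω →ₘ[μ] ℝ}
    (hf : f ∈ X.carrier) (hg : g ∈ X.assoc) (hgi : Integrable g μ) :
    lpNorm (centered (f * g)) 1 μ ≤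
      X.norm f * X.assocNorm (centered g) + X.assocNorm g * X.norm (centered f) := by
  obtain ⟨C, -, hL1⟩ := X.exists_integral_abs_le hμ hX
  have hfi := (hL1 f hf).1
  have hgf := (integrable_mul_and_integral_mul_le hg hf).1
  have hfg : Integrable (fun x => f x * g x) μ :=
    hgf.congr (.of_forall fun x => mul_comm _ _)
  set w := centered (f * g) with hw
  have hm : Measurable fun x => if 0 ≤ w x then (1 : ℝ) else -1 :=
    Measurable.ite (measurableSet_le measurable_const w.measurable) measurable_const
      measurable_const
  let h : Ω →ₘ[μ] ℝ := AEEqFun.mk _ hm.aestronglyMeasurable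
  have hhe : h =ᵐ[μ] fun x => if 0 ≤ w x then (1 : ℝ) else -1 := AEEqFun.coeFn_mk _ _
  have hh : ∀ᵐ x ∂μ, |h x| ≤ 1 := by
    filter_upwards [hhe] with x hx
    rw [hx]
    split_ifs <;> simp
  have hbdd : ∀ {k : Ω → ℝ}, Integrable k μ → Integrable (fun x => h x * k x) μ := fun hk =>
    hk.bdd_mul h.aestronglyMeasurable hh
  have h1 : ∫ x, ‖w x‖ ∂μ = ∫ x, (h x * leibnizOp μ 1 g (centered f) x +
      h x * leibnizOp μ 1 (centered g) f x) ∂μ := integral_congr_ae (by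
    filter_upwards [hhe, coeFn_centered_mul hfi hgi hfg] with x hx hx'
    rw [leibnizOp_one_comm (centered g) f, ← mul_add, ← hx', hx, ← hw, Real.norm_eq_abs]
    split_ifs with h0
    · rw [abs_of_nonneg h0, one_mul]
    · rw [abs_of_neg (not_le.1 h0), neg_one_mul])
  have hcg : Integrable (fun x => centered g x * f x) μ :=
    (integrable_mul_centered hfi hfg).congr (.of_forall fun x => mul_comm _ _)
  rw [lpNorm_one_eq_integral_norm w.aestronglyMeasurable, h1, integral_add
    (hbdd (Integrable.leibnizOp hgi (integrable_centered hfi) (integrable_mul_centered hgi hgf)))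
    (hbdd (Integrable.leibnizOp (integrable_centered hgi) hfi hcg))]
  have h2 := integral_mul_leibnizOp_le hμ hX (centered_mem hμ hX hf) hg hgi hh
  have h3 := integral_mul_leibnizOp_le hμ hX hf
    (sub_const_mem_assoc hμ hX hg (coeFn_centered g)) (integrable_centered hgi) hh
  linarith

end BanachFunctionSpace

end LeibnizInequalities

theorem theorem4p3 {Ω : Type*} [MeasurableSpace Ω] (μ : Measure Ω) [IsProbabilityMeasure μ]
    (hμ : IsNonatomicMeasure μ ∨ IsEquiAtomicMeasure μ)
    (X : BanachFunctionSpace μ) (hX : X.RearrangementInvariant) :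
    (∀ f ∈ X.carrier, ∀ g ∈ X.carrier, MemLp f ∞ μ → MemLp g ∞ μ →
      centered (f * g) ∈ X.carrier ∧ centered f ∈ X.carrier ∧ centered g ∈ X.carrier ∧
      X.norm (centered (f * g)) ≤
        lpNorm f ∞ μ * X.norm (centered g) + lpNorm g ∞ μ * X.norm (centered f)) ∧
    (∀ f ∈ X.carrier, ∀ g ∈ X.assoc,
      Integrable f μ ∧ (X.carrier ≠ ⊥ → Integrable g μ) ∧ Integrable (f * g : Ω →ₘ[μ] ℝ) μ ∧
      centered f ∈ X.carrier ∧ centered g ∈ X.assoc ∧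
      lpNorm (centered (f * g)) 1 μ ≤
        X.norm f * X.assocNorm (centered g) + X.assocNorm g * X.norm (centered f)) := by
  have hs : HasStepApproximations μ :=
    hμ.elim IsNonatomicMeasure.hasStepApproximations IsEquiAtomicMeasure.hasStepApproximations
  obtain ⟨C, -, hL1⟩ := X.exists_integral_abs_le hs hX
  refine ⟨fun f hf g hg hfb hgb => ?_, fun f hf g hg => ?_⟩
  · have h1 := X.norm_centered_mul_le hs hX hf hg hfb hgb
    exact ⟨h1.1, X.centered_mem hs hX hf, X.centered_mem hs hX hg, h1.2⟩
  · have hgf := (X.integrable_mul_and_integral_mul_le hg hf).1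
    refine ⟨(hL1 f hf).1, fun h0 => X.integrable_of_mem_assoc hs hX h0 hg, ?_,
      X.centered_mem hs hX hf, X.sub_const_mem_assoc hs hX hg (coeFn_centered g), ?_⟩
    · refine hgf.congr ?_
      filter_upwards [AEEqFun.coeFn_mul f g] with x hx
      rw [hx, Pi.mul_apply, mul_comm]
    · by_cases h0 : X.carrier = ⊥
      -- Here `g` need not be integrable, but both sides are zero.
      · obtain rfl : f = 0 := by simpa [h0] using hf
        have hz : (0 : Ω →ₘ[μ] ℝ) * g = 0 := AEEqFun.ext (by
          filter_upwards [AEEqFun.coeFn_mul 0 g, AEEqFun.coeFn_zero (α := Ω) (β := ℝ) (μ := μ)]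
            with x hx hx'
          simp [hx, hx'])
        rw [hz, centered_zero, X.norm_zero,
          (lpNorm_eq_zero (f := (0 : Ω →ₘ[μ] ℝ))
            (memLp_congr_ae AEEqFun.coeFn_zero |>.2 MemLp.zero) one_ne_zero).2
            AEEqFun.coeFn_zero]
        simp
      · exact X.lpNorm_one_centered_mul_le hs hX hf hg (X.integrable_of_mem_assoc hs hX h0 hg)
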